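/- Manifolds are Hausdorff, second countable and without boundary. Let $\mathcal M$ and $\mathcal N$ be $C^2$ manifolds, $M:=\dim\mathcal M$, let $L\ge 1$ and $h\ge 0$ be integers with $h+1\le M$. For $r\in\{0,1\}$, $\mathrm{Mat}_L C^r\mathcal F^h$ denotes the $L\times L$ matrices whose entries are differential $h$-forms of class $C^r$, i.e. forms whose coefficients in every $C^2$ chart are of class $C^r$; exterior derivative $d$, pullback and integral are taken entrywise, and $(\lambda\wedge\varphi)^{(ij)}=\sum_s\lambda^{(is)}\wedge\varphi^{(sj)}$. A form $\mu\in\mathrm{Mat}_L C^0\mathcal F^h(\mathcal M)$ has the distributional exterior derivative $\delta\mu\in\mathrm{Mat}_L C^0\mathcal F^{h+1}(\mathcal M)$ if $$\int_{U}\mu\wedge d\varphi=(-1)^{h+1}\int_{U}\delta\mu\wedge\varphi$$ for every oriented open set $U\subset\mathcal M$ and every matrix $\varphi$ of $(M-h-1)$-forms of class $C^1$ with compact support contained in $U$ (if $\mathcal M$ is oriented, it is equivalent to require this for $U=\mathcal M$ only). A point $P\in\mathcal M$ is an $m$-density point of $\mathcal E\subset\mathcal M$ if there is a $C^1$ chart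 $(\mathcal W,\Phi)$ of $\mathcal M$ with $P\in\mathcal W$ and $$\mathcal L^M\bigl(B_r(\Phi(P))\setminus\Phi(\mathcal E\cap\mathcal W)\bigr)=o(r^m)\qquad(r\to0+);$$ the set of these points is denoted by $\mathcal E^{(m)}$. Let $f:\mathcal M\to\mathcal N$ be a map of class $C^1$, let $\omega\in\mathrm{Mat}_L C^1\mathcal F^h(\mathcal N)$, and let $\mu\in\mathrm{Mat}_L C^0\mathcal F^h(\mathcal M)$ have the distributional exterior derivative $\delta\mu\in\mathrm{Mat}_L C^0\mathcal F^{h+1}(\mathcal M)$. Put $$\mathcal A:=\{P\in\mathcal M\mid \mu_P=(f^*\omega)_P\}.$$ Then $(\delta\mu)_Q=(f^*d\omega)_Q$ for every $Q\in\mathcal A^{(M+1)}$. -/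

import Mathlib

open scoped Manifold Topology

noncomputable section

namespace ManifoldForms

/-- The exterior product of alternating forms (shuffle convention: `(dx ∧ dy)(e₁, e₂) = 1`),
with the total degree `m = k + l` given by an equation. -/
def wedge {E : Type*} [AddCommGroup E] [Module ℝ E] [TopologicalSpace E] {k l m : ℕ} (hm : k + l = m)
    (a : E [⋀^Fin k]→L[ℝ] ℝ) (b : E [⋀^Fin l]→L[ℝ] ℝ) : E [⋀^Fin m]→L[ℝ] ℝ :=
  { ((LinearMap.mul' ℝ ℝ).compAlternatingMap
      (a.toAlternatingMap.domCoprod b.toAlternatingMap)).domDomCongr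
        (finSumFinEquiv.trans (finCongr hm)) with
    cont := by
      change Continuous fun v : Fin m → E =>
        (LinearMap.mul' ℝ ℝ) ((a.toAlternatingMap.domCoprod b.toAlternatingMap)
          fun i => v ((finSumFinEquiv.trans (finCongr hm)) i))
      simp only [AlternatingMap.domCoprod_apply, sum_apply, map_sum]
      refine continuous_finsetSum _ fun σ _ => ?_
      induction σ using Quotient.inductionOn' with
      | h σ =>
        have hc : Continuous fun v : Fin m → E =>
            (Equiv.Perm.sign σ : ℤ) •
              (a (fun i => v (finCongr hm (finSumFinEquiv (σ (Sum.inl i))))) *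
                b (fun i => v (finCongr hm (finSumFinEquiv (σ (Sum.inr i)))))) := by
          have ha : Continuous fun v : Fin m → E =>
              fun i => v (finCongr hm (finSumFinEquiv (σ (Sum.inl i)))) :=
            continuous_pi fun i => continuous_apply _
          have hb : Continuous fun v : Fin m → E =>
              fun i => v (finCongr hm (finSumFinEquiv (σ (Sum.inr i)))) :=
            continuous_pi fun i => continuous_apply _
          exact ((a.cont.comp ha).mul (b.cont.comp hb)).const_smul (Equiv.Perm.sign σ : ℤ)
        refine hc.congr fun v => ?_
        rw [AlternatingMap.domCoprod.summand_mk'', Units.smul_def, smul_apply, map_zsmul]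
        rfl }

/-- Differential `h`-forms, of no regularity, on an `n`-dimensional manifold without boundary. -/
abbrev Form (n : ℕ) (M : Type*) [TopologicalSpace M]
    [ChartedSpace (EuclideanSpace ℝ (Fin n)) M] (h : ℕ) : Type _ :=
  (p : M) → TangentSpace (𝓡 n) p [⋀^Fin h]→L[ℝ] ℝ

/-- `L × L` matrices of differential forms. -/
abbrev MatForm (L n : ℕ) (M : Type*) [TopologicalSpace M]
    [ChartedSpace (EuclideanSpace ℝ (Fin n)) M] (h : ℕ) : Type _ :=
  Matrix (Fin L) (Fin L) (Form n M h)

section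

variable {n : ℕ} {M : Type*} [TopologicalSpace M] [ChartedSpace (EuclideanSpace ℝ (Fin n)) M]
variable {n' : ℕ} {N : Type*} [TopologicalSpace N] [ChartedSpace (EuclideanSpace ℝ (Fin n')) N]
variable {h L : ℕ}

/-- The pullback `f^* ω`. -/
def pullback (f : M → N) (ω : Form n' N h) : Form n M h :=
  fun p => (ω (f p)).compContinuousLinearMap (mfderiv (𝓡 n) (𝓡 n') f p)

/-- The representation `(e⁻¹)^* ω` of a form in a chart `e`, meaningful on `e.target`. -/
def coordRep (e : OpenPartialHomeomorph M (EuclideanSpace ℝ (Fin n))) (ω : Form n M h) :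
    EuclideanSpace ℝ (Fin n) → EuclideanSpace ℝ (Fin n) [⋀^Fin h]→L[ℝ] ℝ :=
  fun y => (ω (e.symm y)).compContinuousLinearMap (mfderiv (𝓡 n) (𝓡 n) e.symm y)

/-- `ω` is of class `C^r` on the open set `U`: its representations in all charts of the `C^2`
structure are of class `C^r` there. It is only used with `r ≤ 1`. -/
def IsCrOn (r : WithTop ℕ∞) (ω : Form n M h) (U : Set M) : Prop :=
  ∀ e ∈ IsManifold.maximalAtlas (𝓡 n) 2 M,
    ContDiffOn ℝ r (coordRep e ω) (e.target ∩ e.symm ⁻¹' U)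

/-- `ω` is a form of class `C^r` on `M`. -/
def IsCr (r : WithTop ℕ∞) (ω : Form n M h) : Prop := IsCrOn r ω Set.univ

/-- The support of a form. -/
def supp (ω : Form n M h) : Set M := closure {p | ω p ≠ 0}

/-- The exterior derivative of a form of class `C^1`, computed at `p` in the preferred chart
around `p`. -/
def extD (ω : Form n M h) : Form n M (h + 1) :=
  fun p => (extDeriv (coordRep (chartAt (EuclideanSpace ℝ (Fin n)) p) ω)
    (chartAt (EuclideanSpace ℝ (Fin n)) p p)).compContinuousLinearMap
      (mfderiv (𝓡 n) (𝓡 n) (chartAt (EuclideanSpace ℝ (Fin n)) p) p)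

/-- The exterior product of matrix valued forms. -/
def matWedge {k l m : ℕ} (hm : k + l = m) (a : MatForm L n M k) (b : MatForm L n M l) :
    MatForm L n M m :=
  fun i j p => ∑ s : Fin L, wedge (E := TangentSpace (𝓡 n) p) hm (a i s p) (b s j p)

/-- The nowhere vanishing continuous `n`-form `σ` on the open set `U` orients `U`: a basis
`v` of `T_pM`, `p ∈ U`, is positive if `σ_p(v) > 0`. -/
def IsOrientationOn (σ : Form n M n) (U : Set M) : Prop :=
  IsOpen U ∧ IsCrOn 0 σ U ∧ ∀ p ∈ U, σ p ≠ 0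

/-- The value on the standard basis of the representation in `e` of an `n`-form `α`, that is, the
function `F` with `(e⁻¹)^* α = F dx₁ ∧ … ∧ dxₙ`. -/
def coeff (e : OpenPartialHomeomorph M (EuclideanSpace ℝ (Fin n))) (α : Form n M n)
    (y : EuclideanSpace ℝ (Fin n)) : ℝ :=
  coordRep e α y fun i => EuclideanSpace.basisFun (Fin n) ℝ i

theorem exists_partitionOfUnity (n : ℕ) (M : Type*) [TopologicalSpace M]
    [ChartedSpace (EuclideanSpace ℝ (Fin n)) M] [T2Space M] [SecondCountableTopology M] :
    ∃ ρ : PartitionOfUnity M M,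
      ρ.IsSubordinate fun p => (chartAt (EuclideanSpace ℝ (Fin n)) p).source := by
  have : LocallyCompactSpace M := ChartedSpace.locallyCompactSpace (EuclideanSpace ℝ (Fin n)) M
  exact PartitionOfUnity.exists_isSubordinate isClosed_univ _
    (fun p => (chartAt (EuclideanSpace ℝ (Fin n)) p).open_source)
    (fun p _ => Set.mem_iUnion.2 ⟨p, mem_chart_source _ p⟩)

/-- A continuous partition of unity on `M` subordinate to the preferred charts. -/
def chartPartition (n : ℕ) (M : Type*) [TopologicalSpace M]
    [ChartedSpace (EuclideanSpace ℝ (Fin n)) M] [T2Space M] [SecondCountableTopology M] :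
    PartitionOfUnity M M :=
  (exists_partitionOfUnity n M).choose

/-- The integral of a continuous `n`-form `α` whose compact support lies in an open set oriented
by `σ`: the form is cut into pieces by a partition of unity, and each piece is integrated in its
chart, with the sign `±1` according to whether the chart is positive at the point. -/
def integral [T2Space M] [SecondCountableTopology M] (σ α : Form n M n) : ℝ :=
  ∑ᶠ p : M, ∫ y in (chartAt (EuclideanSpace ℝ (Fin n)) p).target,
    chartPartition n M p ((chartAt (EuclideanSpace ℝ (Fin n)) p).symm y) *
      (SignType.sign (coeff (chartAt (EuclideanSpace ℝ (Fin n)) p) σ y) : ℝ) *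
        coeff (chartAt (EuclideanSpace ℝ (Fin n)) p) α y

/-- `δ` is the distributional exterior derivative of `lam`:
`∫_U lam ∧ dφ = (-1)^(h+1) ∫_U δ ∧ φ` for every oriented open set `U` and every matrix valued
test form `φ` of class `C^1` and of degree `q = n - h - 1` with compact support in `U`. If `M` is
oriented, this amounts to the same identity for `U = M` alone. -/
def IsDED [T2Space M] [SecondCountableTopology M] (lam : MatForm L n M h)
    (δ : MatForm L n M (h + 1)) : Prop :=
  ∀ (U : Set M) (σ : Form n M n), IsOrientationOn σ U →
    ∀ (q : ℕ) (hq : (h + 1) + q = n) (φ : MatForm L n M q),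
      (∀ i j, IsCr 1 (φ i j) ∧ IsCompact (supp (φ i j)) ∧ supp (φ i j) ⊆ U) →
        ∀ i j,
          integral σ (matWedge (show h + (q + 1) = n by omega) lam (φ.map extD) i j) =
            (-1) ^ (h + 1) * integral σ (matWedge hq δ φ i j)

/-- The set of `m`-density points of `A` relative to `M`. -/
def densityPoints (n : ℕ) {M : Type*} [TopologicalSpace M]
    [ChartedSpace (EuclideanSpace ℝ (Fin n)) M] (m : ℝ) (A : Set M) : Set M :=
  {p | ∃ e ∈ IsManifold.maximalAtlas (𝓡 n) 1 M, p ∈ e.source ∧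
    (fun r : ℝ => (MeasureTheory.volume (Metric.ball (e p) r \ e '' (A ∩ e.source))).toReal)
      =o[𝓝[>] 0] fun r : ℝ => r ^ m}

end

end ManifoldForms

end

/-!
In charts of `M` around `Q` and of `N` around `f Q`, testing the distributional identity with
`χ c`, for `χ` a cutoff and `c` a constant form, shows that `δμ` is the weak exterior derivative of
`μ`; since `d (f^* ω) = f^* dω` holds weakly for `f` of class `C^1`, the difference `η = μ - f^* ω`
is a continuous form with a continuous weak exterior derivative `θ = δμ - f^* dω`. Now test `η`
with a bump function at scale `r`: its gradient is `O(1 / r)`, and `η` vanishes in the ball of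
radius `r` outside a set of measure `o(r^(n+1))`, so that `∫ χ θ = o(r^n)`. Dividing by the volume
of the ball, `θ Q = 0`.
-/

noncomputable section

namespace ManifoldForms

open MeasureTheory Filter

section Wedge

variable {E : Type*} [AddCommGroup E] [Module ℝ E] [TopologicalSpace E] {k l m : ℕ}

theorem wedge_apply_of_eq_alternatization (hm : k + l = m) {a : E [⋀^Fin k]→L[ℝ] ℝ}
    {b : E [⋀^Fin l]→L[ℝ] ℝ} {A : MultilinearMap ℝ (fun _ : Fin k => E) ℝ}
    {B : MultilinearMap ℝ (fun _ : Fin l => E) ℝ}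
    (ha : a.toAlternatingMap = MultilinearMap.alternatization A)
    (hb : b.toAlternatingMap = MultilinearMap.alternatization B) (v : Fin m → E) :
    wedge hm a b v = ∑ σ : Equiv.Perm (Fin m), ((Equiv.Perm.sign σ : ℤ) : ℝ) *
      (A (fun i => v (σ (finCongr hm (Fin.castAdd l i)))) *
        B (fun j => v (σ (finCongr hm (Fin.natAdd k j))))) := by
  let ε : Fin k ⊕ Fin l ≃ Fin m := finSumFinEquiv.trans (finCongr hm)
  calc wedge hm a b v
      = LinearMap.mul' ℝ ℝ
          (a.toAlternatingMap.domCoprod b.toAlternatingMap fun i => v (ε i)) := rfl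
    _ = ∑ σ : Equiv.Perm (Fin k ⊕ Fin l), ((Equiv.Perm.sign σ : ℤ) : ℝ) *
          (A (fun i => v (ε (σ (Sum.inl i)))) * B (fun j => v (ε (σ (Sum.inr j))))) := by
        rw [ha, hb, ← MultilinearMap.domCoprod_alternization, MultilinearMap.alternatization_apply,
          map_sum]
        refine Finset.sum_congr rfl fun σ _ => ?_
        rw [Units.smul_def, map_zsmul, zsmul_eq_mul]
        rfl
    _ = _ := by
        refine Fintype.sum_equiv (Equiv.permCongr ε) _ _ fun σ => ?_
        simp only [Equiv.Perm.sign_permCongr, Equiv.permCongr_apply]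
        congr! 3 <;> simp [ε]

theorem sum_sign_mul_apply_comp_perm (a : E [⋀^Fin k]→L[ℝ] ℝ) (v : Fin k → E) :
    ∑ σ : Equiv.Perm (Fin k), ((Equiv.Perm.sign σ : ℤ) : ℝ) * a (fun i => v (σ i)) =
      k.factorial * a v := by
  have h := DFunLike.congr_fun (a.toAlternatingMap.coe_alternatization) v
  simpa [MultilinearMap.alternatization_apply, Units.smul_def] using h

theorem eq_alternatization (a : E [⋀^Fin k]→L[ℝ] ℝ) :
    a.toAlternatingMap = MultilinearMap.alternatization
      ((k.factorial : ℝ)⁻¹ • (a.toAlternatingMap : MultilinearMap ℝ (fun _ : Fin k => E) ℝ)) := by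
  ext v
  refine mul_left_cancel₀ (Nat.cast_ne_zero.2 k.factorial_ne_zero)
    ((sum_sign_mul_apply_comp_perm a v).symm.trans ?_)
  simp only [MultilinearMap.alternatization_apply, Finset.mul_sum]
  refine Finset.sum_congr rfl fun σ _ => ?_
  simp only [MultilinearMap.domDomCongr_apply, smul_apply, ContinuousMultilinearMap.coe_coe,
    ContinuousAlternatingMap.coe_toContinuousMultilinearMap, smul_eq_mul, Units.smul_def,
    zsmul_eq_mul]
  field_simp

theorem wedge_apply (hm : k + l = m) (a : E [⋀^Fin k]→L[ℝ] ℝ) (b : E [⋀^Fin l]→L[ℝ] ℝ)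
    (v : Fin m → E) :
    wedge hm a b v = ∑ σ : Equiv.Perm (Fin m), ((Equiv.Perm.sign σ : ℤ) : ℝ) *
      (((k.factorial : ℝ)⁻¹ * a (fun i => v (σ (finCongr hm (Fin.castAdd l i))))) *
        ((l.factorial : ℝ)⁻¹ * b (fun j => v (σ (finCongr hm (Fin.natAdd k j)))))) :=
  wedge_apply_of_eq_alternatization hm (eq_alternatization a) (eq_alternatization b) v

theorem wedge_add_left (hm : k + l = m) (a a' : E [⋀^Fin k]→L[ℝ] ℝ) (b : E [⋀^Fin l]→L[ℝ] ℝ) :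
    wedge hm (a + a') b = wedge hm a b + wedge hm a' b := by
  ext v
  simp [wedge_apply, add_mul, mul_add, Finset.sum_add_distrib]

theorem wedge_smul_left (hm : k + l = m) (r : ℝ) (a : E [⋀^Fin k]→L[ℝ] ℝ)
    (b : E [⋀^Fin l]→L[ℝ] ℝ) : wedge hm (r • a) b = r • wedge hm a b := by
  ext v
  simp only [wedge_apply, ContinuousAlternatingMap.smul_apply, smul_eq_mul, Finset.mul_sum]
  exact Finset.sum_congr rfl fun σ _ => by ring

theorem wedge_smul_right (hm : k + l = m) (r : ℝ) (a : E [⋀^Fin k]→L[ℝ] ℝ)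
    (b : E [⋀^Fin l]→L[ℝ] ℝ) : wedge hm a (r • b) = r • wedge hm a b := by
  ext v
  simp only [wedge_apply, ContinuousAlternatingMap.smul_apply, smul_eq_mul, Finset.mul_sum]
  exact Finset.sum_congr rfl fun σ _ => by ring

theorem wedge_zero_right (hm : k + l = m) (a : E [⋀^Fin k]→L[ℝ] ℝ) :
    wedge hm a (0 : E [⋀^Fin l]→L[ℝ] ℝ) = 0 := by
  simpa using wedge_smul_right hm 0 a 0

theorem wedge_constOfIsEmpty_one (a : E [⋀^Fin k]→L[ℝ] ℝ) :
    wedge (add_zero k) a (ContinuousAlternatingMap.constOfIsEmpty ℝ E (Fin 0) 1) = a := by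
  ext v
  have h := DFunLike.congr_fun (eq_alternatization a) v
  rw [MultilinearMap.alternatization_apply] at h
  refine (wedge_apply _ _ _ v).trans (Eq.trans (Finset.sum_congr rfl fun σ _ => ?_) h.symm)
  simp [Units.smul_def]

theorem wedge_compContinuousLinearMap {E' : Type*} [AddCommGroup E'] [Module ℝ E']
    [TopologicalSpace E'] (hm : k + l = m) (a : E [⋀^Fin k]→L[ℝ] ℝ)
    (b : E [⋀^Fin l]→L[ℝ] ℝ) (g : E' →L[ℝ] E) :
    (wedge hm a b).compContinuousLinearMap g =
      wedge hm (a.compContinuousLinearMap g) (b.compContinuousLinearMap g) := by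
  ext v
  simp only [wedge_apply, ContinuousAlternatingMap.compContinuousLinearMap_apply,
    Function.comp_def]

theorem sum_sign_mul_comp_perm {V : Type*} (π : Equiv.Perm (Fin m)) (G : (Fin m → V) → ℝ)
    (v : Fin m → V) :
    ∑ σ : Equiv.Perm (Fin m), ((Equiv.Perm.sign σ : ℤ) : ℝ) * G (fun i => v (σ (π i))) =
      ((Equiv.Perm.sign π : ℤ) : ℝ) *
        ∑ σ : Equiv.Perm (Fin m), ((Equiv.Perm.sign σ : ℤ) : ℝ) * G (fun i => v (σ i)) := by
  rw [Finset.mul_sum]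
  refine Fintype.sum_equiv (Equiv.mulRight π) _ _ fun σ => ?_
  have hπ : ((Equiv.Perm.sign π : ℤ) : ℝ) * ((Equiv.Perm.sign π : ℤ) : ℝ) = 1 := by
    rcases Int.units_eq_one_or (Equiv.Perm.sign π) with h | h <;> simp [h]
  simp only [Equiv.coe_mulRight, Equiv.Perm.sign_mul, Equiv.Perm.mul_apply, Units.val_mul,
    Int.cast_mul]
  linear_combination (-((Equiv.Perm.sign σ : ℤ) : ℝ) * G fun i => v (σ (π i))) * hπ

end Wedge

section Covector

variable {E : Type*} [NormedAddCommGroup E] [NormedSpace ℝ E] {k l m : ℕ}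

/-- The exterior product `ℓ ∧ a` of a covector with a form; being written with
`alternatizeUncurryFin`, it is directly comparable with `extDeriv`. -/
def covecWedge (ℓ : E →L[ℝ] ℝ) (a : E [⋀^Fin k]→L[ℝ] ℝ) : E [⋀^Fin (k + 1)]→L[ℝ] ℝ :=
  ContinuousAlternatingMap.alternatizeUncurryFin (ℓ.smulRight a)

theorem covecWedge_apply (ℓ : E →L[ℝ] ℝ) (a : E [⋀^Fin k]→L[ℝ] ℝ) (v : Fin (k + 1) → E) :
    covecWedge ℓ a v =
      ∑ i : Fin (k + 1), (-1) ^ (i : ℕ) * (ℓ (v i) * a (fun j => v (i.succAbove j))) := by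
  simp only [covecWedge, ContinuousAlternatingMap.alternatizeUncurryFin_apply]
  refine Finset.sum_congr rfl fun i _ => ?_
  rw [zsmul_eq_mul]
  push_cast
  rfl

theorem covecWedge_eq_alternatization (ℓ : E →L[ℝ] ℝ) (a : E [⋀^Fin k]→L[ℝ] ℝ) :
    (covecWedge ℓ a).toAlternatingMap = MultilinearMap.alternatization
      (LinearMap.uncurryLeft (ℓ.toLinearMap.smulRight ((k.factorial : ℝ)⁻¹ •
        (a.toAlternatingMap : MultilinearMap ℝ (fun _ : Fin k => E) ℝ)))) := by
  ext v
  let S : ℝ := ∑ σ : Equiv.Perm (Fin (k + 1)), ((Equiv.Perm.sign σ : ℤ) : ℝ) *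
    (ℓ (v (σ 0)) * a (fun j => v (σ j.succ)))
  -- Up to a cyclic permutation, all `k + 1` terms of `ℓ ∧ a` have the same antisymmetrization.
  have hterm (i : Fin (k + 1)) : ∑ σ : Equiv.Perm (Fin (k + 1)), ((Equiv.Perm.sign σ : ℤ) : ℝ) *
      (ℓ (v (σ i)) * a (fun j => v (σ (i.succAbove j)))) = (-1) ^ (i : ℕ) * S := by
    simpa [S] using
      sum_sign_mul_comp_perm i.cycleRange.symm (fun w => ℓ (w 0) * a fun j => w j.succ) v
  have hS : k.factorial * covecWedge ℓ a v = S := by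
    refine mul_left_cancel₀ (Nat.cast_add_one_ne_zero k : (k : ℝ) + 1 ≠ 0) ?_
    calc ((k : ℝ) + 1) * (k.factorial * covecWedge ℓ a v)
        = ∑ σ : Equiv.Perm (Fin (k + 1)), ((Equiv.Perm.sign σ : ℤ) : ℝ) *
            covecWedge ℓ a (fun i => v (σ i)) := by
          rw [sum_sign_mul_apply_comp_perm, Nat.factorial_succ]
          push_cast
          ring
      _ = ∑ i : Fin (k + 1), (-1) ^ (i : ℕ) * ((-1) ^ (i : ℕ) * S) := by
          simp only [covecWedge_apply, Finset.mul_sum, mul_left_comm _ ((-1 : ℝ) ^ _)]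
          rw [Finset.sum_comm]
          simp only [← Finset.mul_sum, hterm]
      _ = ((k : ℝ) + 1) * S := by simp [← mul_assoc, ← mul_pow]
  calc covecWedge ℓ a v = (k.factorial : ℝ)⁻¹ * S := by rw [← hS]; field_simp
    _ = _ := by
        rw [MultilinearMap.alternatization_apply, Finset.mul_sum]
        refine Finset.sum_congr rfl fun σ _ => ?_
        rw [Units.smul_def, zsmul_eq_mul, mul_left_comm, mul_left_comm _ (ℓ _)]
        rfl

theorem wedge_covecWedge (hm : k + (l + 1) = m) (hm' : k + 1 + l = m) (ℓ : E →L[ℝ] ℝ)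
    (a : E [⋀^Fin k]→L[ℝ] ℝ) (c : E [⋀^Fin l]→L[ℝ] ℝ) :
    wedge hm a (covecWedge ℓ c) = (-1 : ℝ) ^ k • wedge hm' (covecWedge ℓ a) c := by
  ext v
  obtain ⟨m, rfl⟩ : ∃ m', m = m' + 1 := ⟨k + l, by omega⟩
  let K : Fin (m + 1) := finCongr hm (Fin.natAdd k 0)
  have hK_zero : K.cycleRange.symm (finCongr hm' (Fin.castAdd l 0)) = K :=
    Fin.cycleRange_symm_zero K
  have hK_left (i : Fin k) : K.cycleRange.symm (finCongr hm' (Fin.castAdd l i.succ)) =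
      finCongr hm (Fin.castAdd (l + 1) i) := by
    have h := Fin.cycleRange_symm_succ K ⟨i, by omega⟩
    rwa [Fin.succAbove_of_castSucc_lt _ _ (by simp [K, Fin.lt_def])] at h
  have hK_right (j : Fin l) : K.cycleRange.symm (finCongr hm' (Fin.natAdd (k + 1) j)) =
      finCongr hm (Fin.natAdd k j.succ) := by
    have h := Fin.cycleRange_symm_succ K ⟨k + j, by omega⟩
    rw [Fin.succAbove_of_le_castSucc _ _ (by simp [K, Fin.le_def])] at h
    convert h using 2 <;> ext <;> simp <;> omega
  have hsign : ((Equiv.Perm.sign K.cycleRange.symm : ℤ) : ℝ) = (-1) ^ k := by simp [K]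
  rw [ContinuousAlternatingMap.smul_apply, smul_eq_mul,
    wedge_apply_of_eq_alternatization hm (eq_alternatization a) (covecWedge_eq_alternatization ℓ c),
    wedge_apply_of_eq_alternatization hm' (covecWedge_eq_alternatization ℓ a)
      (eq_alternatization c), ← hsign]
  refine Eq.trans (Finset.sum_congr rfl fun σ _ => ?_) (sum_sign_mul_comp_perm K.cycleRange.symm
    (fun w => (ℓ (w (finCongr hm' (Fin.castAdd l 0))) *
      ((k.factorial : ℝ)⁻¹ * a fun i => w (finCongr hm' (Fin.castAdd l i.succ)))) *
        ((l.factorial : ℝ)⁻¹ * c fun j => w (finCongr hm' (Fin.natAdd (k + 1) j)))) v)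
  simp only [hK_zero, hK_left, hK_right]
  rw [mul_comm (ℓ _), mul_assoc]
  rfl

/-- The map `a ↦ (a ∧ c)(v)` as a continuous linear functional, through which the exterior product
passes under the integral sign. -/
def wedgeCLM (hm : k + l = m) (c : E [⋀^Fin l]→L[ℝ] ℝ) (v : Fin m → E) :
    (E [⋀^Fin k]→L[ℝ] ℝ) →L[ℝ] ℝ where
  toFun a := wedge hm a c v
  map_add' a a' := by rw [wedge_add_left]; rfl
  map_smul' r a := by rw [wedge_smul_left]; rfl
  cont := by
    simp only [wedge_apply]
    refine continuous_finsetSum _ fun σ _ => continuous_const.mul (Continuous.mul ?_ ?_)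
    · exact continuous_const.mul (ContinuousAlternatingMap.apply ℝ E ℝ _).continuous
    · exact continuous_const

theorem eq_zero_of_covecWedge_eq_zero [FiniteDimensional ℝ E] (hk : k < Module.finrank ℝ E)
    {θ : E [⋀^Fin k]→L[ℝ] ℝ} (h : ∀ ℓ : E →L[ℝ] ℝ, covecWedge ℓ θ = 0) : θ = 0 := by
  ext v
  have hspan : Submodule.span ℝ (Set.range v) < ⊤ :=
    Submodule.lt_top_of_finrank_lt_finrank
      ((finrank_range_le_card v).trans_lt (by rwa [Fintype.card_fin]))
  obtain ⟨ℓ, hℓ, hspan_le⟩ := Submodule.exists_le_ker_of_lt_top _ hspan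
  obtain ⟨x, hx⟩ := LinearMap.surjective hℓ 1
  have hℓv (j : Fin k) : ℓ (v j) = 0 := hspan_le (Submodule.subset_span ⟨j, rfl⟩)
  have happly := covecWedge_apply ℓ.toContinuousLinearMap θ (Fin.cons x v : Fin (k + 1) → E)
  rw [h, Fin.sum_univ_succ] at happly
  simpa [hx, hℓv] using happly.symm

theorem eq_zero_of_wedge_eq_zero [FiniteDimensional ℝ E] (hm : k + l = m)
    (hmE : m ≤ Module.finrank ℝ E) {θ : E [⋀^Fin k]→L[ℝ] ℝ}
    (h : ∀ c : E [⋀^Fin l]→L[ℝ] ℝ, wedge hm θ c = 0) : θ = 0 := by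
  induction l generalizing k with
  | zero =>
    subst hm
    exact (wedge_constOfIsEmpty_one θ).symm.trans (h _)
  | succ l ih =>
    refine eq_zero_of_covecWedge_eq_zero (by omega) fun ℓ => ih (by omega) fun c => ?_
    have hc := wedge_covecWedge hm (by omega) ℓ θ c
    rw [h] at hc
    exact (smul_eq_zero.1 hc.symm).resolve_left (by simp)

end Covector

section Pullback

variable {E F : Type*} [NormedAddCommGroup E] [NormedSpace ℝ E]
  [NormedAddCommGroup F] [NormedSpace ℝ F] {k : ℕ}

theorem norm_alternatization_le (A : ContinuousMultilinearMap ℝ (fun _ : Fin k => E) ℝ) :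
    ‖ContinuousMultilinearMap.alternatization A‖ ≤ k.factorial * ‖A‖ := by
  refine ContinuousAlternatingMap.opNorm_le_bound _ (by positivity) fun v => ?_
  rw [ContinuousMultilinearMap.alternatization_apply_apply]
  have hterm (σ : Equiv.Perm (Fin k)) : ‖Equiv.Perm.sign σ • A (v ∘ σ)‖ ≤ ‖A‖ * ∏ i, ‖v i‖ := by
    have hsign : ‖Equiv.Perm.sign σ • A (v ∘ σ)‖ = ‖A (v ∘ σ)‖ := by
      rcases Int.units_eq_one_or (Equiv.Perm.sign σ) with h | h <;> simp [h]
    rw [hsign, ← Equiv.prod_comp σ fun i => ‖v i‖]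
    exact A.le_opNorm _
  calc ‖∑ σ : Equiv.Perm (Fin k), Equiv.Perm.sign σ • A (v ∘ σ)‖
      ≤ ∑ _σ : Equiv.Perm (Fin k), ‖A‖ * ∏ i, ‖v i‖ := norm_sum_le_of_le _ fun σ _ => hterm σ
    _ = k.factorial * ‖A‖ * ∏ i, ‖v i‖ := by simp [Fintype.card_perm, mul_assoc]

/-- The antisymmetrization of continuous multilinear forms as a continuous linear map, normalized
to be a left inverse of the inclusion of alternating forms. -/
def antisymmCLM (k : ℕ) (E : Type*) [NormedAddCommGroup E] [NormedSpace ℝ E] :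
    (ContinuousMultilinearMap ℝ (fun _ : Fin k => E) ℝ) →L[ℝ] (E [⋀^Fin k]→L[ℝ] ℝ) :=
  ((k.factorial : ℝ)⁻¹) • LinearMap.mkContinuous
    { toFun := ContinuousMultilinearMap.alternatization
      map_add' := map_add _
      map_smul' := fun r A => by
        ext v
        simp [ContinuousMultilinearMap.alternatization_apply_apply, Finset.mul_sum,
          Units.smul_def, mul_left_comm] } (k.factorial : ℝ) norm_alternatization_le

theorem antisymmCLM_toContinuousMultilinearMap (a : E [⋀^Fin k]→L[ℝ] ℝ) :
    antisymmCLM k E a.toContinuousMultilinearMap = a := by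
  apply ContinuousAlternatingMap.toAlternatingMap_injective
  rw [eq_alternatization a]
  ext v
  simp [antisymmCLM, MultilinearMap.alternatization_apply, Finset.mul_sum, Units.smul_def,
    mul_left_comm]

theorem contDiff_compContinuousLinearMap {r : WithTop ℕ∞} :
    ContDiff ℝ r fun p : (F [⋀^Fin k]→L[ℝ] ℝ) × (E →L[ℝ] F) =>
      p.1.compContinuousLinearMap p.2 := by
  have h : ContDiff ℝ r fun p : (F [⋀^Fin k]→L[ℝ] ℝ) × (E →L[ℝ] F) =>
      antisymmCLM k E
        ((ContinuousMultilinearMap.compContinuousLinearMapContinuousMultilinear ℝ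
          (fun _ : Fin k => E) (fun _ => F) ℝ (fun _ => p.2))
            (ContinuousAlternatingMap.toContinuousMultilinearMapCLM ℝ p.1)) := by
    refine (antisymmCLM k E).contDiff.comp (ContDiff.clm_apply ?_ ?_)
    · exact (ContinuousMultilinearMap.contDiff _).comp (contDiff_pi.2 fun _ => contDiff_snd)
    · exact (ContinuousLinearMap.contDiff _).comp contDiff_fst
  convert h using 2 with p
  exact (antisymmCLM_toContinuousMultilinearMap (p.1.compContinuousLinearMap p.2)).symm

theorem continuous_compContinuousLinearMap :
    Continuous fun p : (F [⋀^Fin k]→L[ℝ] ℝ) × (E →L[ℝ] F) =>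
      p.1.compContinuousLinearMap p.2 :=
  (contDiff_compContinuousLinearMap (r := 0)).continuous

/-- `covecWedge` as a continuous bilinear map. -/
def covecWedgeCLM (k : ℕ) (E : Type*) [NormedAddCommGroup E] [NormedSpace ℝ E] :
    (E →L[ℝ] ℝ) →L[ℝ] (E [⋀^Fin k]→L[ℝ] ℝ) →L[ℝ] E [⋀^Fin (k + 1)]→L[ℝ] ℝ :=
  (ContinuousLinearMap.compL ℝ _ _ _
    (ContinuousAlternatingMap.alternatizeUncurryFinCLM ℝ E ℝ)).comp
      (ContinuousLinearMap.smulRightL ℝ E (E [⋀^Fin k]→L[ℝ] ℝ))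

theorem norm_covecWedge_le (ℓ : E →L[ℝ] ℝ) (a : E [⋀^Fin k]→L[ℝ] ℝ) :
    ‖covecWedge ℓ a‖ ≤ (k + 1) * (‖ℓ‖ * ‖a‖) := by
  rw [← ContinuousLinearMap.norm_smulRight_apply]
  exact ContinuousAlternatingMap.norm_alternatizeUncurryFin_le _

theorem continuous_covecWedge :
    Continuous fun p : (E →L[ℝ] ℝ) × (E [⋀^Fin k]→L[ℝ] ℝ) => covecWedge p.1 p.2 :=
  ((covecWedgeCLM k E).continuous.comp continuous_fst).clm_apply continuous_snd

theorem covecWedge_sub (ℓ : E →L[ℝ] ℝ) (a b : E [⋀^Fin k]→L[ℝ] ℝ) :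
    covecWedge ℓ (a - b) = covecWedge ℓ a - covecWedge ℓ b :=
  map_sub (covecWedgeCLM k E ℓ) a b

theorem covecWedge_zero_left (a : E [⋀^Fin k]→L[ℝ] ℝ) : covecWedge (0 : E →L[ℝ] ℝ) a = 0 :=
  (covecWedgeCLM k E).map_zero₂ a

theorem covecWedge_zero_right (ℓ : E →L[ℝ] ℝ) : covecWedge ℓ (0 : E [⋀^Fin k]→L[ℝ] ℝ) = 0 :=
  map_zero (covecWedgeCLM k E ℓ)

theorem extDeriv_fun_const (a : E [⋀^Fin k]→L[ℝ] ℝ) (x : E) : extDeriv (fun _ => a) x = 0 := by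
  rw [extDeriv, fderiv_fun_const]
  exact map_zero (ContinuousAlternatingMap.alternatizeUncurryFinCLM ℝ E ℝ)

theorem extDeriv_smul_fun {χ : E → ℝ} {η : E → E [⋀^Fin k]→L[ℝ] ℝ} {x : E}
    (hχ : DifferentiableAt ℝ χ x) (hη : DifferentiableAt ℝ η x) :
    extDeriv (fun y => χ y • η y) x = covecWedge (fderiv ℝ χ x) (η x) + χ x • extDeriv η x := by
  rw [extDeriv, fderiv_fun_smul hχ hη, ContinuousAlternatingMap.alternatizeUncurryFin_add,
    ContinuousAlternatingMap.alternatizeUncurryFin_smul]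
  exact add_comm _ _

theorem continuous_extDeriv {η : E → E [⋀^Fin k]→L[ℝ] ℝ} (hη : ContDiff ℝ 1 η) :
    Continuous (extDeriv η) :=
  (ContinuousAlternatingMap.alternatizeUncurryFinCLM ℝ E ℝ).continuous.comp
    (hη.continuous_fderiv one_ne_zero)

theorem support_extDeriv_subset (η : E → E [⋀^Fin k]→L[ℝ] ℝ) :
    Function.support (extDeriv η) ⊆ tsupport η := fun x hx => by
  by_contra hxη
  exact hx ((notMem_tsupport_iff_eventuallyEq.1 hxη).extDeriv_eq.trans (extDeriv_fun_const 0 x))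

theorem covecWedge_fderiv_eq_zero_of_notMem_tsupport {χ : E → ℝ} {x : E} (hx : x ∉ tsupport χ)
    (a : E [⋀^Fin k]→L[ℝ] ℝ) : covecWedge (fderiv ℝ χ x) a = 0 := by
  rw [fderiv_of_notMem_tsupport ℝ hx, covecWedge_zero_left]

end Pullback

section WeakExtDeriv

theorem integrable_of_eq_zero_of_notMem_tsupport {X W : Type*} [TopologicalSpace X]
    [MeasurableSpace X] [OpensMeasurableSpace X] {ν : Measure X} [IsFiniteMeasureOnCompacts ν]
    [T2Space X] [NormedAddCommGroup W] {V : Set X} {χ : X → ℝ} (hV : IsOpen V)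
    (hχc : HasCompactSupport χ) (hχV : tsupport χ ⊆ V) {g : X → W} (hg : ContinuousOn g V)
    (h0 : ∀ x ∉ tsupport χ, g x = 0) : Integrable g ν := by
  have hsupp : tsupport g ⊆ tsupport χ := closure_minimal
    (fun x (hx : g x ≠ 0) => by_contra fun h => hx (h0 x h)) (isClosed_tsupport χ)
  exact (hg.continuous_of_tsupport_subset hV (hsupp.trans hχV)).integrable_of_hasCompactSupport
    (HasCompactSupport.intro hχc h0)

variable {E : Type*} [NormedAddCommGroup E] [NormedSpace ℝ E] [MeasurableSpace E] {k : ℕ}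

/-- `θ` is the exterior derivative of `η` on the open set `V` in the sense of distributions, tested
with functions instead of forms: `∫ χ θ = -∫ dχ ∧ η`. -/
def IsWeakExtDerivOn (ν : Measure E) (η : E → E [⋀^Fin k]→L[ℝ] ℝ)
    (θ : E → E [⋀^Fin (k + 1)]→L[ℝ] ℝ) (V : Set E) : Prop :=
  ∀ χ : E → ℝ, ContDiff ℝ (⊤ : ℕ∞) χ → HasCompactSupport χ → tsupport χ ⊆ V →
    ∫ x, (covecWedge (fderiv ℝ χ x) (η x) + χ x • θ x) ∂ν = 0

section Integrable

variable [BorelSpace E] {ν : Measure E} [IsFiniteMeasureOnCompacts ν] {V : Set E}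
  {χ : E → ℝ}

theorem integrable_smul_form (hV : IsOpen V) (hχ : Continuous χ) (hχc : HasCompactSupport χ)
    (hχV : tsupport χ ⊆ V) {θ : E → E [⋀^Fin k]→L[ℝ] ℝ} (hθ : ContinuousOn θ V) :
    Integrable (fun x => χ x • θ x) ν :=
  integrable_of_eq_zero_of_notMem_tsupport hV hχc hχV (hχ.continuousOn.smul hθ) fun x hx => by
    rw [image_eq_zero_of_notMem_tsupport hx, zero_smul]

theorem integrable_covecWedge_fderiv (hV : IsOpen V) (hχ : ContDiff ℝ 1 χ)
    (hχc : HasCompactSupport χ) (hχV : tsupport χ ⊆ V) {η : E → E [⋀^Fin k]→L[ℝ] ℝ}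
    (hη : ContinuousOn η V) : Integrable (fun x => covecWedge (fderiv ℝ χ x) (η x)) ν :=
  integrable_of_eq_zero_of_notMem_tsupport hV hχc hχV
    (continuous_covecWedge.comp_continuousOn
      ((hχ.continuous_fderiv one_ne_zero).continuousOn.prodMk hη))
    fun _ hx => covecWedge_fderiv_eq_zero_of_notMem_tsupport hx _

theorem IsWeakExtDerivOn.sub {η η' : E → E [⋀^Fin k]→L[ℝ] ℝ}
    {θ θ' : E → E [⋀^Fin (k + 1)]→L[ℝ] ℝ} (h : IsWeakExtDerivOn ν η θ V)
    (h' : IsWeakExtDerivOn ν η' θ' V) (hV : IsOpen V) (hη : ContinuousOn η V)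
    (hη' : ContinuousOn η' V) (hθ : ContinuousOn θ V) (hθ' : ContinuousOn θ' V) :
    IsWeakExtDerivOn ν (fun x => η x - η' x) (fun x => θ x - θ' x) V := by
  intro χ hχ hχc hχV
  have hχ1 : ContDiff ℝ 1 χ := hχ.of_le (by simp)
  have hint {η : E → E [⋀^Fin k]→L[ℝ] ℝ} {θ : E → E [⋀^Fin (k + 1)]→L[ℝ] ℝ}
      (hη : ContinuousOn η V) (hθ : ContinuousOn θ V) :
      Integrable (fun x => covecWedge (fderiv ℝ χ x) (η x) + χ x • θ x) ν :=
    Integrable.add (f := fun x => covecWedge (fderiv ℝ χ x) (η x)) (g := fun x => χ x • θ x)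
      (integrable_covecWedge_fderiv hV hχ1 hχc hχV hη)
      (integrable_smul_form hV hχ.continuous hχc hχV hθ)
  calc ∫ x, (covecWedge (fderiv ℝ χ x) (η x - η' x) + χ x • (θ x - θ' x)) ∂ν
      = ∫ x, ((covecWedge (fderiv ℝ χ x) (η x) + χ x • θ x) -
          (covecWedge (fderiv ℝ χ x) (η' x) + χ x • θ' x)) ∂ν := by
        simp only [covecWedge_sub, smul_sub, sub_add_sub_comm]
    _ = 0 := by
        rw [integral_sub (hint hη hθ) (hint hη' hθ'), h χ hχ hχc hχV, h' χ hχ hχc hχV, sub_zero]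

end Integrable

variable [BorelSpace E] [FiniteDimensional ℝ E] {ν : Measure E} [ν.IsAddHaarMeasure]

theorem integral_fderiv_eq_zero {W : Type*} [NormedAddCommGroup W] [NormedSpace ℝ W]
    [CompleteSpace W] {g : E → W} (hg : ContDiff ℝ 1 g) (hc : HasCompactSupport g) :
    ∫ x, fderiv ℝ g x ∂ν = 0 := by
  have hint : Integrable (fderiv ℝ g) ν :=
    (hg.continuous_fderiv one_ne_zero).integrable_of_hasCompactSupport (hc.fderiv ℝ)
  ext v
  rw [ContinuousLinearMap.integral_apply hint]
  have h := integral_smul_fderiv_eq_neg_fderiv_smul_of_integrable (μ := ν) (𝕜 := ℝ)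
    (f := fun _ => (1 : ℝ)) (g := g) (v := v) (by simp)
    (by simpa using hint.apply_continuousLinearMap v)
    (by simpa using hg.continuous.integrable_of_hasCompactSupport hc)
    (fun x _ => differentiableAt_const _) (fun x _ => hg.differentiable one_ne_zero x)
  simpa using h

theorem isWeakExtDerivOn_extDeriv {η : E → E [⋀^Fin k]→L[ℝ] ℝ} (hη : ContDiff ℝ 1 η)
    (V : Set E) : IsWeakExtDerivOn ν η (extDeriv η) V := by
  intro χ hχ hχc _
  have hχ1 : ContDiff ℝ 1 χ := hχ.of_le (by simp)
  have hχη : ContDiff ℝ 1 fun x => χ x • η x := hχ1.smul hη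
  have hχηc : HasCompactSupport fun x => χ x • η x := hχc.smul_right
  have hderiv (x : E) : covecWedge (fderiv ℝ χ x) (η x) + χ x • extDeriv η x =
      ContinuousAlternatingMap.alternatizeUncurryFinCLM ℝ E ℝ (fderiv ℝ (fun y => χ y • η y) x) :=
    (extDeriv_smul_fun (hχ1.differentiable one_ne_zero x) (hη.differentiable one_ne_zero x)).symm
  simp only [hderiv]
  rw [ContinuousLinearMap.integral_comp_comm _
    ((hχη.continuous_fderiv one_ne_zero).integrable_of_hasCompactSupport (hχηc.fderiv ℝ)),
    integral_fderiv_eq_zero hχη hχηc, map_zero]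

end WeakExtDeriv

section Mollify

variable {E F : Type*} [NormedAddCommGroup E] [NormedSpace ℝ E] [FiniteDimensional ℝ E]
  [NormedAddCommGroup F] [NormedSpace ℝ F] {k : ℕ}

theorem norm_normed_convolution_le [CompleteSpace F] [MeasurableSpace E] [BorelSpace E]
    {ν : Measure E} [ν.IsAddHaarMeasure] (φ : ContDiffBump (0 : E)) {g : E → F}
    (hg : Continuous g) {C : ℝ} (hC : ∀ x, ‖g x‖ ≤ C) (x : E) :
    ‖convolution (φ.normed ν) g (ContinuousLinearMap.lsmul ℝ ℝ) ν x‖ ≤ 3 * C := by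
  have hdist := φ.dist_normed_convolution_le (μ := ν) (x₀ := x) (ε := 2 * C)
    hg.aestronglyMeasurable fun y _ => by
      linarith [dist_le_norm_add_norm (g y) (g x), hC x, hC y]
  rw [dist_eq_norm] at hdist
  linarith [norm_le_norm_add_norm_sub' (convolution (φ.normed ν) g
    (ContinuousLinearMap.lsmul ℝ ℝ) ν x) (g x), hC x]

theorem exists_seq_contDiff_tendsto [CompleteSpace F] {f : E → F} (hf : ContDiff ℝ 1 f)
    (hc : HasCompactSupport f) :
    ∃ (g : ℕ → E → F) (C : ℝ), ∀ x,
      (∀ i, ContDiff ℝ (⊤ : ℕ∞) (g i) ∧ ‖g i x‖ ≤ C ∧ ‖fderiv ℝ (g i) x‖ ≤ C) ∧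
        Tendsto (fun i => g i x) atTop (𝓝 (f x)) ∧
          Tendsto (fun i => fderiv ℝ (g i) x) atTop (𝓝 (fderiv ℝ f x)) := by
  borelize E
  let ν : Measure E := Measure.addHaar
  let φ : ℕ → ContDiffBump (0 : E) := fun i =>
    ⟨1 / ((i : ℝ) + 1), 2 / ((i : ℝ) + 1), by positivity, by gcongr; norm_num⟩
  have hφ : Tendsto (fun i => (φ i).rOut) atTop (𝓝 0) := by
    simpa [φ, div_eq_mul_inv] using
      (tendsto_one_div_add_atTop_nhds_zero_nat (𝕜 := ℝ)).const_mul 2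
  let g : ℕ → E → F := fun i =>
    convolution ((φ i).normed ν) f (ContinuousLinearMap.lsmul ℝ ℝ) ν
  have hdf : Continuous (fderiv ℝ f) := hf.continuous_fderiv one_ne_zero
  have hfderiv_g (i : ℕ) : fderiv ℝ (g i) = convolution ((φ i).normed ν) (fderiv ℝ f)
      (ContinuousLinearMap.lsmul ℝ ℝ) ν := by
    ext1 x
    rw [(hc.hasFDerivAt_convolution_right (ContinuousLinearMap.lsmul ℝ ℝ)
      ((φ i).continuous_normed.locallyIntegrable (μ := ν)) hf x).fderiv]
    rfl
  obtain ⟨C, hC⟩ := hc.exists_bound_of_continuous hf.continuous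
  obtain ⟨C', hC'⟩ := (hc.fderiv ℝ).exists_bound_of_continuous hdf
  refine ⟨g, max (3 * C) (3 * C'), fun x => ⟨fun i => ⟨?_, ?_, ?_⟩, ?_, ?_⟩⟩
  · exact (φ i).hasCompactSupport_normed.contDiff_convolution_left _ (φ i).contDiff_normed
      hf.continuous.locallyIntegrable
  · exact (norm_normed_convolution_le (φ i) hf.continuous hC x).trans (le_max_left _ _)
  · rw [hfderiv_g]
    exact (norm_normed_convolution_le (φ i) hdf hC' x).trans (le_max_right _ _)
  · exact ContDiffBump.convolution_tendsto_right_of_continuous hφ hf.continuous x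
  · simp only [hfderiv_g]
    exact ContDiffBump.convolution_tendsto_right_of_continuous hφ hdf x

theorem tendsto_integral_comp_of_bounded {X W Y : Type*} [TopologicalSpace X] [MeasurableSpace X]
    [OpensMeasurableSpace X] [T2Space X] [SecondCountableTopology X]
    {ν : Measure X} [IsFiniteMeasureOnCompacts ν] [NormedAddCommGroup W] [NormedSpace ℝ W]
    [NormedAddCommGroup Y] [NormedSpace ℝ Y] [FiniteDimensional ℝ Y]
    {G : X × Y → W} {K : Set X} (hG : Continuous G) (hK : IsCompact K)
    (hGK : ∀ x ∉ K, ∀ p, G (x, p) = 0) {g : ℕ → X → Y} {g₀ : X → Y} {C : ℝ}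
    (hg : ∀ i, Continuous (g i)) (hC : ∀ i x, ‖g i x‖ ≤ C)
    (hlim : ∀ x, Tendsto (fun i => g i x) atTop (𝓝 (g₀ x))) :
    Tendsto (fun i => ∫ x, G (x, g i x) ∂ν) atTop (𝓝 (∫ x, G (x, g₀ x) ∂ν)) := by
  have : ProperSpace Y := FiniteDimensional.proper_real Y
  obtain ⟨D, hD⟩ := (hK.prod (isCompact_closedBall (0 : Y) C)).exists_bound_of_continuousOn
    hG.continuousOn
  refine tendsto_integral_of_dominated_convergence (K.indicator fun _ => D) (fun i => ?_) ?_
    (fun i => Eventually.of_forall fun x => ?_) (Eventually.of_forall fun x => ?_)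
  · exact (hG.comp (continuous_id.prodMk (hg i))).aestronglyMeasurable
  · exact (integrable_indicator_iff hK.measurableSet).2 (integrableOn_const hK.measure_lt_top.ne)
  · by_cases hx : x ∈ K
    · rw [Set.indicator_of_mem hx]
      exact hD _ ⟨hx, mem_closedBall_zero_iff.2 (hC i x)⟩
    · rw [Set.indicator_of_notMem hx, hGK x hx, norm_zero]
  · exact (hG.tendsto _).comp (tendsto_const_nhds.prodMk_nhds (hlim x))

end Mollify

section Pullback

variable {E F : Type*} [NormedAddCommGroup E] [NormedSpace ℝ E] [FiniteDimensional ℝ E]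
  [MeasurableSpace E] [BorelSpace E] {ν : Measure E} [ν.IsAddHaarMeasure]
  [NormedAddCommGroup F] [NormedSpace ℝ F] {k : ℕ} {f : E → F} {ω : F → F [⋀^Fin k]→L[ℝ] ℝ}

theorem isWeakExtDerivOn_pullback_of_contDiff_top (hf : ContDiff ℝ (⊤ : ℕ∞) f)
    (hω : ContDiff ℝ 1 ω) (V : Set E) :
    IsWeakExtDerivOn ν (fun x => (ω (f x)).compContinuousLinearMap (fderiv ℝ f x))
      (fun x => (extDeriv ω (f x)).compContinuousLinearMap (fderiv ℝ f x)) V := by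
  have hη : ContDiff ℝ 1 fun x => (ω (f x)).compContinuousLinearMap (fderiv ℝ f x) :=
    contDiff_compContinuousLinearMap.comp ((hω.comp (hf.of_le (by simp))).prodMk
      (hf.fderiv_right (by norm_cast)))
  have hd : (fun x => (extDeriv ω (f x)).compContinuousLinearMap (fderiv ℝ f x)) =
      extDeriv fun x => (ω (f x)).compContinuousLinearMap (fderiv ℝ f x) := by
    ext1 x
    refine (extDeriv_pullback (hω.differentiable one_ne_zero _) hf.contDiffAt ?_).symm
    rw [minSmoothness_of_isRCLikeNormedField]
    exact WithTop.coe_le_coe.2 le_top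
  rw [hd]
  exact isWeakExtDerivOn_extDeriv hη V

/-- For `f` of class `C^1` the pullback `f^* ω` is only continuous, so `d f^* ω = f^* dω` makes
sense only weakly. -/
theorem isWeakExtDerivOn_pullback [FiniteDimensional ℝ F] (hf : ContDiff ℝ 1 f)
    (hc : HasCompactSupport f) (hω : ContDiff ℝ 1 ω) (V : Set E) :
    IsWeakExtDerivOn ν (fun x => (ω (f x)).compContinuousLinearMap (fderiv ℝ f x))
      (fun x => (extDeriv ω (f x)).compContinuousLinearMap (fderiv ℝ f x)) V := by
  intro χ hχ hχc hχV
  obtain ⟨g, C, hg⟩ := exists_seq_contDiff_tendsto hf hc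
  have hg_smooth (i : ℕ) : ContDiff ℝ (⊤ : ℕ∞) (g i) := ((hg 0).1 i).1
  let G : E × F × (E →L[ℝ] F) → E [⋀^Fin (k + 1)]→L[ℝ] ℝ := fun p =>
    covecWedge (fderiv ℝ χ p.1) ((ω p.2.1).compContinuousLinearMap p.2.2) +
      χ p.1 • (extDeriv ω p.2.1).compContinuousLinearMap p.2.2
  have hG : Continuous G := by
    have hdχ : Continuous (fderiv ℝ χ) := hχ.continuous_fderiv (by simp)
    refine (continuous_covecWedge.comp ((hdχ.comp continuous_fst).prodMk ?_)).add
      ((hχ.continuous.comp continuous_fst).smul ?_)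
    · exact continuous_compContinuousLinearMap.comp
        ((hω.continuous.prodMap continuous_id).comp continuous_snd)
    · exact continuous_compContinuousLinearMap.comp
        (((continuous_extDeriv hω).prodMap continuous_id).comp continuous_snd)
  have hG_zero (x : E) (hx : x ∉ tsupport χ) (p : F × (E →L[ℝ] F)) : G (x, p) = 0 := by
    simp only [G, image_eq_zero_of_notMem_tsupport hx, zero_smul, add_zero,
      covecWedge_fderiv_eq_zero_of_notMem_tsupport hx]
  have hlim : Tendsto (fun i => ∫ x, G (x, g i x, fderiv ℝ (g i) x) ∂ν) atTop
      (𝓝 (∫ x, G (x, f x, fderiv ℝ f x) ∂ν)) :=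
    tendsto_integral_comp_of_bounded (g := fun i x => (g i x, fderiv ℝ (g i) x)) hG hχc hG_zero
      (fun i => (hg_smooth i).continuous.prodMk ((hg_smooth i).continuous_fderiv (by simp)))
      (fun i x => max_le ((hg x).1 i).2.1 ((hg x).1 i).2.2)
      (fun x => (hg x).2.1.prodMk_nhds (hg x).2.2)
  refine tendsto_nhds_unique hlim (tendsto_const_nhds.congr fun i => ?_)
  exact (isWeakExtDerivOn_pullback_of_contDiff_top (hg_smooth i) hω V χ hχ hχc hχV).symm

end Pullback

section Density

/-- `x₀` is an `m`-density point of `Z`: the relative measure of the complement of `Z` in the ball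
`B_r(x₀)` is `o(r ^ m)`. -/
def IsDensityPoint {X : Type*} [PseudoMetricSpace X] [MeasurableSpace X] (ν : Measure X) (m : ℝ)
    (Z : Set X) (x₀ : X) : Prop :=
  (fun r : ℝ => (ν (Metric.ball x₀ r \ Z)).toReal) =o[𝓝[>] 0] fun r : ℝ => r ^ m

variable {E : Type*} [NormedAddCommGroup E] [NormedSpace ℝ E] [FiniteDimensional ℝ E]
  [MeasurableSpace E]

theorem norm_integral_covecWedge_fderiv_le {k : ℕ} {ν : Measure E} [IsFiniteMeasureOnCompacts ν]
    {η : E → E [⋀^Fin k]→L[ℝ] ℝ} {χ : E → ℝ} {x₀ : E} {r B D : ℝ}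
    (hχ : tsupport χ ⊆ Metric.ball x₀ r) (hB : ∀ x, ‖fderiv ℝ χ x‖ ≤ B)
    (hD : ∀ x ∈ Metric.ball x₀ r, ‖η x‖ ≤ D) :
    ‖∫ x, covecWedge (fderiv ℝ χ x) (η x) ∂ν‖ ≤
      ((k : ℝ) + 1) * (B * D) * ν.real (Metric.ball x₀ r \ {x | η x = 0}) := by
  have hzero (x : E) (hx : x ∉ Metric.ball x₀ r \ {x | η x = 0}) :
      covecWedge (fderiv ℝ χ x) (η x) = 0 := by
    by_cases hxχ : x ∈ tsupport χ
    · have hηx : η x = 0 := by_contra fun h => hx ⟨hχ hxχ, h⟩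
      rw [hηx, covecWedge_zero_right]
    · exact covecWedge_fderiv_eq_zero_of_notMem_tsupport hxχ _
  rw [← setIntegral_eq_integral_of_forall_compl_eq_zero hzero]
  refine norm_setIntegral_le_of_norm_le_const
    ((measure_mono Set.sdiff_subset).trans_lt measure_ball_lt_top) fun x hx => ?_
  refine (norm_covecWedge_le _ _).trans ?_
  have hB0 : 0 ≤ B := (norm_nonneg _).trans (hB x)
  gcongr
  exacts [hB x, hD x hx.1]

variable [BorelSpace E]

theorem exists_contDiff_approximate_identity (ν : Measure E) [ν.IsAddHaarMeasure] (x₀ : E) :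
    ∃ (C : ℝ) (χ : ℝ → E → ℝ), ∀ r > 0, ContDiff ℝ (⊤ : ℕ∞) (χ r) ∧
      tsupport (χ r) ⊆ Metric.ball x₀ r ∧ (∀ x, 0 ≤ χ r x) ∧ ∫ x, χ r x ∂ν = 1 ∧
        ∀ x, ‖fderiv ℝ (χ r) x‖ ≤ C / r ^ (Module.finrank ℝ E + 1) := by
  let b : ContDiffBump (0 : E) := ⟨1 / 4, 1 / 2, by norm_num, by norm_num⟩
  have hb : ContDiff ℝ (⊤ : ℕ∞) b := b.contDiff
  obtain ⟨C, hC⟩ := (b.hasCompactSupport.fderiv ℝ).exists_bound_of_continuous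
    (hb.continuous_fderiv (by simp))
  set n := Module.finrank ℝ E
  set c := ∫ x, b x ∂ν
  have hc : 0 < c := b.integral_pos
  refine ⟨c⁻¹ * C, fun r x => (c * r ^ n)⁻¹ * b (r⁻¹ • (x - x₀)), fun r hr =>
    ⟨?_, ?_, fun x => mul_nonneg (by positivity) b.nonneg, ?_, fun x => ?_⟩⟩
  · exact contDiff_const.mul (hb.comp ((contDiff_id.sub contDiff_const).const_smul r⁻¹))
  · refine (closure_minimal (fun x hx => ?_) Metric.isClosed_closedBall).trans
      (Metric.closedBall_subset_ball (half_lt_self hr))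
    have hx' : r⁻¹ • (x - x₀) ∈ Function.support b := right_ne_zero_of_mul hx
    rw [b.support_eq, mem_ball_zero_iff, norm_smul, norm_inv, Real.norm_of_nonneg hr.le,
      inv_mul_lt_iff₀ hr] at hx'
    rw [Metric.mem_closedBall, dist_eq_norm]
    exact (hx'.trans_eq (mul_one_div r 2)).le
  · rw [integral_const_mul, integral_sub_right_eq_self (fun x => b (r⁻¹ • x)) x₀,
      Measure.integral_comp_inv_smul_of_nonneg ν b hr.le, smul_eq_mul, mul_comm _ c]
    exact inv_mul_cancel₀ (by positivity)
  · have haff : HasFDerivAt (fun x : E => r⁻¹ • (x - x₀)) (r⁻¹ • ContinuousLinearMap.id ℝ E) x :=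
      ((hasFDerivAt_id x).sub_const x₀).const_smul r⁻¹
    have hder := ((hb.differentiable (by simp) _).hasFDerivAt.comp x haff).const_mul (c * r ^ n)⁻¹
    simp only [Function.comp_def, ContinuousLinearMap.comp_smul,
      ContinuousLinearMap.comp_id] at hder
    rw [hder.fderiv, norm_smul, norm_smul, norm_inv, norm_inv, Real.norm_of_nonneg hr.le,
      Real.norm_of_nonneg (by positivity)]
    calc (c * r ^ n)⁻¹ * (r⁻¹ * ‖fderiv ℝ b (r⁻¹ • (x - x₀))‖)
        ≤ (c * r ^ n)⁻¹ * (r⁻¹ * C) := by gcongr; exact hC _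
      _ = c⁻¹ * C / r ^ (n + 1) := by field_simp; ring

theorem tendsto_integral_smul_of_tsupport_subset_ball {X W : Type*} [MetricSpace X] [ProperSpace X]
    [MeasurableSpace X] [BorelSpace X] {ν : Measure X} [IsFiniteMeasureOnCompacts ν]
    [NormedAddCommGroup W] [NormedSpace ℝ W] [CompleteSpace W] {χ : ℝ → X → ℝ} {x₀ : X}
    (hχ : ∀ r > 0, Continuous (χ r)) (hsupp : ∀ r > 0, tsupport (χ r) ⊆ Metric.ball x₀ r)
    (h_nonneg : ∀ r > 0, ∀ x, 0 ≤ χ r x) (h_int : ∀ r > 0, ∫ x, χ r x ∂ν = 1) {V : Set X}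
    (hV : V ∈ 𝓝 x₀) {g : X → W} (hg : ContinuousOn g V) :
    Tendsto (fun r => ∫ x, χ r x • g x ∂ν) (𝓝[>] 0) (𝓝 (g x₀)) := by
  obtain ⟨R, hR, hRV⟩ := Metric.nhds_basis_closedBall.mem_iff.1 hV
  set s := Metric.closedBall x₀ R
  have hpos : ∀ᶠ r : ℝ in 𝓝[>] 0, 0 < r := self_mem_nhdsWithin
  have hzero {ρ : ℝ} (hρ : 0 < ρ) : ∀ᶠ r in 𝓝[>] 0, ∀ x ∉ Metric.ball x₀ ρ, χ r x = 0 := by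
    filter_upwards [Ioo_mem_nhdsGT hρ] with r hr x hx
    exact image_eq_zero_of_notMem_tsupport fun h =>
      hx (Metric.ball_subset_ball hr.2.le (hsupp r hr.1 h))
  have hzero_s : ∀ᶠ r in 𝓝[>] 0, ∀ x ∉ s, χ r x = 0 :=
    (hzero hR).mono fun r h x hx => h x fun hx' => hx (Metric.ball_subset_closedBall hx')
  have hlim : Tendsto (fun r => ∫ x in s, χ r x • g x ∂ν) (𝓝[>] 0) (𝓝 (g x₀)) := by
    refine tendsto_setIntegral_peak_smul_of_integrableOn_of_tendsto
      Metric.isClosed_closedBall.measurableSet Metric.isClosed_closedBall.measurableSet subset_rfl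
      self_mem_nhdsWithin measure_closedBall_lt_top.ne (hpos.mono fun r hr x _ => h_nonneg r hr x)
      (fun u hu hx₀ => ?_) ?_ (hpos.mono fun r hr => (hχ r hr).aestronglyMeasurable)
      ((hg.mono hRV).integrableOn_compact (isCompact_closedBall x₀ R))
      ((hg.continuousAt hV).tendsto.mono_left nhdsWithin_le_nhds)
    · obtain ⟨ρ, hρ, hρu⟩ := Metric.isOpen_iff.1 hu x₀ hx₀
      refine Metric.tendstoUniformlyOn_iff.2 fun ε hε => (hzero hρ).mono fun r h x hx => ?_
      rwa [h x fun hx' => hx.2 (hρu hx'), Pi.zero_apply, dist_self]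
    · refine tendsto_const_nhds.congr' ((hpos.and hzero_s).mono fun r h => ?_)
      exact ((setIntegral_eq_integral_of_forall_compl_eq_zero h.2).trans (h_int r h.1)).symm
  refine hlim.congr' (hzero_s.mono fun r h => ?_)
  exact setIntegral_eq_integral_of_forall_compl_eq_zero fun x hx => by rw [h x hx, zero_smul]

theorem IsWeakExtDerivOn.eq_zero_of_isDensityPoint {k : ℕ} {ν : Measure E} [ν.IsAddHaarMeasure]
    {η : E → E [⋀^Fin k]→L[ℝ] ℝ} {θ : E → E [⋀^Fin (k + 1)]→L[ℝ] ℝ} {V : Set E} {x₀ : E}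
    (h : IsWeakExtDerivOn ν η θ V) (hV : IsOpen V) (hx₀ : x₀ ∈ V) (hη : ContinuousOn η V)
    (hθ : ContinuousOn θ V)
    (hdens : IsDensityPoint ν (Module.finrank ℝ E + 1) {x | η x = 0} x₀) : θ x₀ = 0 := by
  obtain ⟨C, χ, hχ⟩ := exists_contDiff_approximate_identity ν x₀
  obtain ⟨R, hR, hRV⟩ := Metric.nhds_basis_closedBall.mem_iff.1 (hV.mem_nhds hx₀)
  obtain ⟨D, hD⟩ := (isCompact_closedBall x₀ R).exists_bound_of_continuousOn (hη.mono hRV)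
  set n := Module.finrank ℝ E
  have hlim_θ : Tendsto (fun r => ∫ x, χ r x • θ x ∂ν) (𝓝[>] 0) (𝓝 (θ x₀)) :=
    tendsto_integral_smul_of_tsupport_subset_ball (fun r hr => (hχ r hr).1.continuous)
      (fun r hr => (hχ r hr).2.1) (fun r hr => (hχ r hr).2.2.1) (fun r hr => (hχ r hr).2.2.2.1)
      (hV.mem_nhds hx₀) hθ
  have hbound : ∀ᶠ r in 𝓝[>] 0, ‖∫ x, χ r x • θ x ∂ν‖ ≤ ((k : ℝ) + 1) * (C * D) *
      ((ν (Metric.ball x₀ r \ {x | η x = 0})).toReal / r ^ ((n : ℝ) + 1)) := by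
    filter_upwards [Ioo_mem_nhdsGT hR] with r ⟨hr, hrR⟩
    obtain ⟨hχr, hsupp, -, -, hder⟩ := hχ r hr
    have hball : Metric.ball x₀ r ⊆ Metric.closedBall x₀ R :=
      Metric.ball_subset_closedBall.trans (Metric.closedBall_subset_closedBall hrR.le)
    have hχc : HasCompactSupport (χ r) := (isCompact_closedBall x₀ R).of_isClosed_subset
      (isClosed_tsupport _) (hsupp.trans hball)
    have hχV : tsupport (χ r) ⊆ V := hsupp.trans (hball.trans hRV)
    have hweak := h (χ r) hχr hχc hχV
    rw [integral_add (integrable_covecWedge_fderiv hV (hχr.of_le (by simp)) hχc hχV hη)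
      (integrable_smul_form hV hχr.continuous hχc hχV hθ)] at hweak
    rw [eq_neg_of_add_eq_zero_right hweak, norm_neg]
    refine (norm_integral_covecWedge_fderiv_le hsupp hder fun x hx => hD x (hball hx)).trans_eq ?_
    rw [← Real.rpow_natCast, Nat.cast_succ, Measure.real]
    ring
  have hlim_zero : Tendsto (fun r => ∫ x, χ r x • θ x ∂ν) (𝓝[>] 0) (𝓝 0) :=
    squeeze_zero_norm' hbound (by simpa using hdens.tendsto_div_nhds_zero.const_mul _)
  exact tendsto_nhds_unique hlim_θ hlim_zero

end Density

section DensityTransfer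

theorem tendsto_const_mul_nhdsGT_zero {c : ℝ} (hc : 0 < c) :
    Tendsto (fun r : ℝ => c * r) (𝓝[>] 0) (𝓝[>] 0) :=
  tendsto_nhdsWithin_iff.2 ⟨((continuous_const_mul c).tendsto' 0 0 (mul_zero c)).mono_left
    nhdsWithin_le_nhds, eventually_mem_nhdsWithin.mono fun _ hr => mul_pos hc hr⟩

theorem IsDensityPoint.mono {X : Type*} [PseudoMetricSpace X] [ProperSpace X] [MeasurableSpace X]
    {ν : Measure X} [IsFiniteMeasureOnCompacts ν] {m : ℝ} {A B : Set X} {x₀ : X}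
    (hA : IsDensityPoint ν m A x₀) (hAB : ∀ᶠ x in 𝓝 x₀, x ∈ A → x ∈ B) :
    IsDensityPoint ν m B x₀ := by
  obtain ⟨R, hR, hball⟩ := Metric.eventually_nhds_iff_ball.1 hAB
  refine Asymptotics.IsBigO.trans_isLittleO (Asymptotics.IsBigO.of_bound' ?_) hA
  filter_upwards [Ioo_mem_nhdsGT hR] with r hr
  rw [Real.norm_of_nonneg ENNReal.toReal_nonneg, Real.norm_of_nonneg ENNReal.toReal_nonneg]
  refine ENNReal.toReal_mono ((measure_mono Set.sdiff_subset).trans_lt measure_ball_lt_top).ne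
    (measure_mono fun x hx => ⟨hx.1, fun hxA => hx.2 ?_⟩)
  exact hball x (Metric.ball_subset_ball hr.2.le hx.1) hxA

theorem exists_image_ball_subset_ball {E F : Type*} [NormedAddCommGroup E] [NormedSpace ℝ E]
    [NormedAddCommGroup F] [NormedSpace ℝ F] {T : E → F} {x₀ : E} (hT : ContDiffAt ℝ 1 T x₀) :
    ∃ c > 0, ∀ᶠ r in 𝓝[>] (0 : ℝ), T '' Metric.ball x₀ r ⊆ Metric.ball (T x₀) (c * r) := by
  obtain ⟨K, t, ht, hK⟩ := hT.exists_lipschitzOnWith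
  obtain ⟨R, hR, hRt⟩ := Metric.mem_nhds_iff.1 ht
  refine ⟨K + 1, by positivity, ?_⟩
  filter_upwards [Ioo_mem_nhdsGT hR] with r ⟨hr, hrR⟩
  rintro _ ⟨x, hx, rfl⟩
  calc dist (T x) (T x₀)
      ≤ K * dist x x₀ :=
        hK.dist_le_mul x (hRt (Metric.ball_subset_ball hrR.le hx)) x₀ (mem_of_mem_nhds ht)
    _ ≤ K * r := by gcongr; exact (Metric.mem_ball.1 hx).le
    _ < (K + 1) * r := by linarith

variable {E : Type*} [NormedAddCommGroup E] [NormedSpace ℝ E] [FiniteDimensional ℝ E]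
  [MeasurableSpace E] [BorelSpace E] {ν : Measure E} [ν.IsAddHaarMeasure]

theorem exists_measure_image_le_mul {S : E → E} {y₀ : E} (hS : ContDiffAt ℝ 1 S y₀) :
    ∃ c : NNReal, ∃ s ∈ 𝓝 y₀, ∀ t ⊆ s, ν (S '' t) ≤ c * ν t := by
  obtain ⟨c, hc⟩ := exists_gt ‖(fderiv ℝ S y₀).det‖₊
  have hc' : ENNReal.ofReal |(fderiv ℝ S y₀).det| < c := by
    rw [← Real.norm_eq_abs, ofReal_norm]
    exact ENNReal.coe_lt_coe.2 hc
  obtain ⟨δ, hδ, hδ0⟩ := ((addHaar_image_le_mul_of_det_lt ν _ hc').and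
    self_mem_nhdsWithin).exists
  obtain ⟨s, hs, hSs⟩ :=
    (hS.hasStrictFDerivAt one_ne_zero).approximates_deriv_on_nhds (c := δ) (Or.inr hδ0)
  exact ⟨c, s, hs, fun t ht => hδ t S (hSs.mono_set ht)⟩

theorem IsDensityPoint.preimage {m : ℝ} {T S : E → E} {x₀ : E} {B : Set E}
    (hT : ContDiffAt ℝ 1 T x₀) (hS : ContDiffAt ℝ 1 S (T x₀)) (hST : ∀ᶠ x in 𝓝 x₀, S (T x) = x)
    (hB : IsDensityPoint ν m B (T x₀)) : IsDensityPoint ν m (T ⁻¹' B) x₀ := by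
  obtain ⟨a, s, hs, hvol⟩ := exists_measure_image_le_mul (ν := ν) hS
  obtain ⟨c, hc, hball⟩ := exists_image_ball_subset_ball hT
  obtain ⟨R, hR, hnear⟩ := Metric.eventually_nhds_iff_ball.1
    (hST.and (hT.continuousAt.eventually (eventually_mem_set.2 hs)))
  have hscaled : (fun r : ℝ => (ν (Metric.ball (T x₀) (c * r) \ B)).toReal) =o[𝓝[>] 0]
      fun r : ℝ => (c * r) ^ m := hB.comp_tendsto (tendsto_const_mul_nhdsGT_zero hc)
  refine Asymptotics.IsBigO.trans_isLittleO (Asymptotics.IsBigO.of_bound a ?_)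
    (hscaled.trans_isBigO (Asymptotics.IsBigO.of_bound (c ^ m) ?_))
  · filter_upwards [hball, Ioo_mem_nhdsGT hR] with r hr ⟨_, hrR⟩
    rw [Real.norm_of_nonneg ENNReal.toReal_nonneg, Real.norm_of_nonneg ENNReal.toReal_nonneg]
    have hsub : Metric.ball x₀ r \ T ⁻¹' B ⊆ S '' ((Metric.ball (T x₀) (c * r) \ B) ∩ s) := by
      rintro x ⟨hx, hxB⟩
      obtain ⟨hSx, hxs⟩ := hnear x (Metric.ball_subset_ball hrR.le hx)
      exact ⟨T x, ⟨⟨hr ⟨x, hx, rfl⟩, hxB⟩, hxs⟩, hSx⟩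
    have hle : ν (Metric.ball x₀ r \ T ⁻¹' B) ≤ a * ν (Metric.ball (T x₀) (c * r) \ B) :=
      calc ν (Metric.ball x₀ r \ T ⁻¹' B)
          ≤ ν (S '' ((Metric.ball (T x₀) (c * r) \ B) ∩ s)) := measure_mono hsub
        _ ≤ a * ν ((Metric.ball (T x₀) (c * r) \ B) ∩ s) := hvol _ Set.inter_subset_right
        _ ≤ a * ν (Metric.ball (T x₀) (c * r) \ B) := by gcongr; exact Set.inter_subset_left
    have hfin : ν (Metric.ball (T x₀) (c * r) \ B) ≠ ⊤ :=
      ((measure_mono Set.sdiff_subset).trans_lt measure_ball_lt_top).ne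
    simpa using ENNReal.toReal_mono (ENNReal.mul_ne_top ENNReal.coe_ne_top hfin) hle
  · filter_upwards [self_mem_nhdsWithin] with r hr
    rw [Real.mul_rpow hc.le (le_of_lt hr), norm_mul, Real.norm_of_nonneg (by positivity)]

end DensityTransfer

section Local

variable {E F : Type*} [NormedAddCommGroup E] [NormedSpace ℝ E] [FiniteDimensional ℝ E]
  [NormedAddCommGroup F] [NormedSpace ℝ F]

theorem exists_contDiff_hasCompactSupport_eventuallyEq {g : E → F} {x : E}
    (hg : ContDiffAt ℝ 1 g x) :
    ∃ g' : E → F, ContDiff ℝ 1 g' ∧ HasCompactSupport g' ∧ g' =ᶠ[𝓝 x] g := by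
  obtain ⟨R, hR, hgR⟩ := Metric.eventually_nhds_iff_ball.1 (hg.eventually (by simp))
  let b : ContDiffBump x := ⟨R / 3, R / 2, by positivity, by linarith⟩
  have hb : tsupport b ⊆ Metric.ball x R := by
    rw [b.tsupport_eq]
    exact Metric.closedBall_subset_ball (half_lt_self hR)
  refine ⟨fun y => b y • g y, contDiff_iff_contDiffAt.2 fun y => ?_,
    b.hasCompactSupport.smul_right, b.eventuallyEq_one.mono fun y hy => ?_⟩
  · by_cases hy : y ∈ tsupport b
    · exact b.contDiffAt.smul (hgR y (hb hy))
    · exact (contDiffAt_const (c := (0 : F))).congr_of_eventuallyEq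
        ((notMem_tsupport_iff_eventuallyEq.1 hy).mono fun z hz => by simp [hz])
  · simp only [hy, Pi.one_apply, one_smul]

theorem IsWeakExtDerivOn.eq_pullback_extDeriv_of_isDensityPoint [FiniteDimensional ℝ F]
    [MeasurableSpace E] [BorelSpace E] {ν : Measure E} [ν.IsAddHaarMeasure] {k : ℕ}
    {η : E → E [⋀^Fin k]→L[ℝ] ℝ} {θ : E → E [⋀^Fin (k + 1)]→L[ℝ] ℝ} {V : Set E}
    (h : IsWeakExtDerivOn ν η θ V) (hV : IsOpen V) (hη : ContinuousOn η V)
    (hθ : ContinuousOn θ V) {x₀ : E} (hx₀ : x₀ ∈ V) {f : E → F} (hf : ContDiffAt ℝ 1 f x₀)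
    {ω : F → F [⋀^Fin k]→L[ℝ] ℝ} (hω : ContDiffAt ℝ 1 ω (f x₀))
    (hdens : IsDensityPoint ν (Module.finrank ℝ E + 1)
      {x | η x = (ω (f x)).compContinuousLinearMap (fderiv ℝ f x)} x₀) :
    θ x₀ = (extDeriv ω (f x₀)).compContinuousLinearMap (fderiv ℝ f x₀) := by
  obtain ⟨f', hf', hf'c, hff'⟩ := exists_contDiff_hasCompactSupport_eventuallyEq hf
  obtain ⟨ω', hω', -, hωω'⟩ := exists_contDiff_hasCompactSupport_eventuallyEq hω
  have hpull : Continuous fun x => (ω' (f' x)).compContinuousLinearMap (fderiv ℝ f' x) :=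
    continuous_compContinuousLinearMap.comp
      ((hω'.continuous.comp hf'.continuous).prodMk (hf'.continuous_fderiv one_ne_zero))
  have hpull' : Continuous fun x => (extDeriv ω' (f' x)).compContinuousLinearMap (fderiv ℝ f' x) :=
    continuous_compContinuousLinearMap.comp
      (((continuous_extDeriv hω').comp hf'.continuous).prodMk (hf'.continuous_fderiv one_ne_zero))
  have hdiff := h.sub (isWeakExtDerivOn_pullback hf' hf'c hω' V) hV hη hpull.continuousOn hθ
    hpull'.continuousOn
  have hzero : ∀ᶠ x in 𝓝 x₀, η x = (ω (f x)).compContinuousLinearMap (fderiv ℝ f x) →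
      η x - (ω' (f' x)).compContinuousLinearMap (fderiv ℝ f' x) = 0 := by
    filter_upwards [hff', hff'.fderiv (𝕜 := ℝ), hf.continuousAt.eventually hωω']
      with x hx hdx hωx hηx
    rw [hηx, hx, hdx, hωx, sub_self]
  have heq := hdiff.eq_zero_of_isDensityPoint hV hx₀ (hη.sub hpull.continuousOn)
    (hθ.sub hpull'.continuousOn) (hdens.mono hzero)
  rw [sub_eq_zero.1 heq, hff'.eq_of_nhds, hff'.fderiv_eq (𝕜 := ℝ), hωω'.extDeriv_eq]

end Local

section Pullback

variable {n : ℕ} {M : Type*} [TopologicalSpace M] [ChartedSpace (EuclideanSpace ℝ (Fin n)) M]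
variable {n' : ℕ} {N : Type*} [TopologicalSpace N] [ChartedSpace (EuclideanSpace ℝ (Fin n')) N]
variable {n'' : ℕ} {P : Type*} [TopologicalSpace P]
  [ChartedSpace (EuclideanSpace ℝ (Fin n'')) P]
variable {k : ℕ} {f : M → N} {p : M}

theorem pullback_congr_form {ω ω' : Form n' N k} (h : ω (f p) = ω' (f p)) :
    pullback (n := n) f ω p = pullback f ω' p := by
  rw [pullback, pullback, h]

theorem pullback_eq_zero {ω : Form n' N k} (h : ω (f p) = 0) :
    pullback (n := n) f ω p = 0 := by
  rw [pullback, h]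
  rfl

theorem pullback_congr_map {g : M → N} (h : f =ᶠ[𝓝 p] g) (ω : Form n' N k) :
    pullback (n := n) f ω p = pullback g ω p := by
  have hval (q : N) (hq : f p = q) (v : Fin k → EuclideanSpace ℝ (Fin n')) :
      (ω (f p) v : ℝ) = ω q v := by subst hq; rfl
  ext v
  refine (hval (g p) h.eq_of_nhds _).trans (congrArg (ω (g p)) (funext fun i => ?_))
  exact congrArg
    (fun A : EuclideanSpace ℝ (Fin n) →L[ℝ] EuclideanSpace ℝ (Fin n') => A (v i)) h.mfderiv_eq

theorem pullback_id (ω : Form n M k) : pullback id ω p = ω p := by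
  ext v
  rw [pullback, mfderiv_id]
  rfl

theorem pullback_pullback {g : N → P} (hg : MDifferentiableAt (𝓡 n') (𝓡 n'') g (f p))
    (hf : MDifferentiableAt (𝓡 n) (𝓡 n') f p) (ω : Form n'' P k) :
    pullback (n := n) f (pullback (n := n') g ω) p = pullback (fun q => g (f q)) ω p := by
  have hcomp : mfderiv (𝓡 n) (𝓡 n'') (fun q => g (f q)) p =
      (mfderiv (𝓡 n') (𝓡 n'') g (f p)).comp (mfderiv (𝓡 n) (𝓡 n') f p) := mfderiv_comp p hg hf
  rw [pullback, pullback, pullback, hcomp]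
  rfl

theorem pullback_eq_compContinuousLinearMap_fderiv
    (τ : EuclideanSpace ℝ (Fin n) → EuclideanSpace ℝ (Fin n'))
    (η : EuclideanSpace ℝ (Fin n') → EuclideanSpace ℝ (Fin n') [⋀^Fin k]→L[ℝ] ℝ)
    (y : EuclideanSpace ℝ (Fin n)) :
    pullback τ η y = (η (τ y)).compContinuousLinearMap (fderiv ℝ τ y) :=
  congrArg (η (τ y)).compContinuousLinearMap mfderiv_eq_fderiv

end Pullback

section CoordRep

variable {n : ℕ} {M : Type*} [TopologicalSpace M] [ChartedSpace (EuclideanSpace ℝ (Fin n)) M]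
variable {n' : ℕ} {N : Type*} [TopologicalSpace N] [ChartedSpace (EuclideanSpace ℝ (Fin n')) N]
variable {k : ℕ} {e e' : OpenPartialHomeomorph M (EuclideanSpace ℝ (Fin n))}
  {y : EuclideanSpace ℝ (Fin n)}

theorem mem_maximalAtlas_one (he : e ∈ IsManifold.maximalAtlas (𝓡 n) 2 M) :
    e ∈ IsManifold.maximalAtlas (𝓡 n) 1 M :=
  IsManifold.maximalAtlas_subset_of_le one_le_two he

theorem contDiffAt_transition {r : WithTop ℕ∞} (he : e ∈ IsManifold.maximalAtlas (𝓡 n) r M)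
    (he' : e' ∈ IsManifold.maximalAtlas (𝓡 n) r M) (hy : y ∈ e'.target)
    (hy' : e'.symm y ∈ e.source) : ContDiffAt ℝ r (fun z => e (e'.symm z)) y :=
  contMDiffAt_iff_contDiffAt.1 ((contMDiffAt_of_mem_maximalAtlas he hy').comp y
    (contMDiffAt_symm_of_mem_maximalAtlas he' hy))

theorem coordRep_eq_pullback (α : Form n M k) (y : EuclideanSpace ℝ (Fin n)) :
    coordRep e α y = pullback e.symm α y := rfl

theorem coordRep_eventuallyEq_zero {α : Form n M k} (hy : y ∈ e.target)
    (hα : ∀ᶠ p in 𝓝 (e.symm y), α p = 0) : coordRep e α =ᶠ[𝓝 y] fun _ => 0 :=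
  ((e.continuousAt_symm hy).eventually hα).mono fun _ => pullback_eq_zero

theorem coordRep_pullback {f : M → N} (ω : Form n' N k)
    {c : OpenPartialHomeomorph N (EuclideanSpace ℝ (Fin n'))}
    (he : e ∈ IsManifold.maximalAtlas (𝓡 n) 1 M) (hc : c ∈ IsManifold.maximalAtlas (𝓡 n') 1 N)
    (hy : y ∈ e.target) (hf : MDifferentiableAt (𝓡 n) (𝓡 n') f (e.symm y))
    (hy' : f (e.symm y) ∈ c.source) :
    coordRep e (pullback f ω) y = (coordRep c ω (c (f (e.symm y)))).compContinuousLinearMap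
      (fderiv ℝ (fun z => c (f (e.symm z))) y) := by
  have hfe := hf.comp y (mdifferentiableAt_symm_of_mem_maximalAtlas he hy)
  have hcfe := (mdifferentiableAt_of_mem_maximalAtlas hc hy').comp y hfe
  have hfactor : (fun z => f (e.symm z)) =ᶠ[𝓝 y] fun z => c.symm (c (f (e.symm z))) := by
    filter_upwards [hfe.continuousAt.eventually (c.open_source.mem_nhds hy')] with z hz
    exact (c.left_inv hz).symm
  refine Eq.trans ?_ (pullback_eq_compContinuousLinearMap_fderiv (fun z => c (f (e.symm z)))
    (coordRep c ω) y)
  calc pullback e.symm (pullback f ω) y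
      = pullback (fun z => f (e.symm z)) ω y :=
        pullback_pullback hf (mdifferentiableAt_symm_of_mem_maximalAtlas he hy) ω
    _ = pullback (fun z => c.symm (c (f (e.symm z)))) ω y := pullback_congr_map hfactor ω
    _ = pullback (fun z => c (f (e.symm z))) (coordRep c ω) y :=
        (pullback_pullback (f := fun z => c (f (e.symm z)))
          (mdifferentiableAt_symm_of_mem_maximalAtlas hc (c.map_source hy'))
          hcfe ω).symm

theorem coordRep_eq_transition (he : e ∈ IsManifold.maximalAtlas (𝓡 n) 1 M)
    (he' : e' ∈ IsManifold.maximalAtlas (𝓡 n) 1 M) (α : Form n M k)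
    (hy : y ∈ e'.target) (hy' : e'.symm y ∈ e.source) :
    coordRep e' α y = (coordRep e α (e (e'.symm y))).compContinuousLinearMap
      (fderiv ℝ (fun z => e (e'.symm z)) y) := by
  have h := coordRep_pullback (f := id) α he' he hy mdifferentiableAt_id hy'
  rwa [coordRep_eq_pullback, pullback_congr_form (pullback_id α)] at h

theorem pullback_coordRep (he : e ∈ IsManifold.maximalAtlas (𝓡 n) 1 M) (α : Form n M k) {p : M}
    (hp : p ∈ e.source) : pullback e (coordRep e α) p = α p :=
  calc pullback e (coordRep e α) p
      = pullback (fun q => e.symm (e q)) α p :=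
        pullback_pullback (mdifferentiableAt_symm_of_mem_maximalAtlas he (e.map_source hp))
          (mdifferentiableAt_of_mem_maximalAtlas he hp) α
    _ = pullback id α p := pullback_congr_map (e.eventually_left_inverse hp) α
    _ = α p := pullback_id α

theorem extD_eq_pullback_extDeriv [IsManifold (𝓡 n) 2 M]
    (he : e ∈ IsManifold.maximalAtlas (𝓡 n) 2 M) {α : Form n M k} {p : M} (hp : p ∈ e.source)
    (hα : DifferentiableAt ℝ (coordRep e α) (e p)) :
    extD α p = pullback e (extDeriv (coordRep e α)) p := by
  let c := chartAt (EuclideanSpace ℝ (Fin n)) p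
  have hc : c ∈ IsManifold.maximalAtlas (𝓡 n) 2 M := IsManifold.chart_mem_maximalAtlas p
  have hpc : p ∈ c.source := mem_chart_source _ p
  have hcp : c p ∈ c.target := c.map_source hpc
  have hce : c.symm (c p) ∈ e.source := by rwa [c.left_inv hpc]
  have hτ := contDiffAt_transition he hc hcp hce
  have htransition : coordRep c α =ᶠ[𝓝 (c p)] fun z =>
      (coordRep e α (e (c.symm z))).compContinuousLinearMap
        (fderiv ℝ (fun z => e (c.symm z)) z) := by
    filter_upwards [c.open_target.eventually_mem hcp,
      (c.continuousAt_symm hcp).eventually (e.open_source.mem_nhds hce)] with z hz hz'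
    exact coordRep_eq_transition (mem_maximalAtlas_one he) (mem_maximalAtlas_one hc) α hz hz'
  have hextDeriv : extDeriv (coordRep c α) (c p) =
      pullback (fun z => e (c.symm z)) (extDeriv (coordRep e α)) (c p) := by
    rw [htransition.extDeriv_eq, pullback_eq_compContinuousLinearMap_fderiv]
    exact extDeriv_pullback (by rwa [c.left_inv hpc]) hτ
      (by rw [minSmoothness_of_isRCLikeNormedField])
  calc extD α p
      = pullback c (extDeriv (coordRep c α)) p := rfl
    _ = pullback c (pullback (fun z => e (c.symm z)) (extDeriv (coordRep e α))) p :=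
        pullback_congr_form hextDeriv
    _ = pullback (fun q => e (c.symm (c q))) (extDeriv (coordRep e α)) p :=
        pullback_pullback (hτ.differentiableAt two_ne_zero).mdifferentiableAt
          (mdifferentiableAt_of_mem_maximalAtlas (mem_maximalAtlas_one hc) hpc) _
    _ = pullback e (extDeriv (coordRep e α)) p :=
        pullback_congr_map ((c.eventually_left_inverse hpc).mono fun _ hq => congrArg e hq) _

theorem extD_eq_zero_of_eventually_eq_zero {α : Form n M k} {p : M}
    (hα : ∀ᶠ q in 𝓝 p, α q = 0) : extD α p = 0 := by
  let c := chartAt (EuclideanSpace ℝ (Fin n)) p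
  have hpc : p ∈ c.source := mem_chart_source _ p
  have hzero : coordRep c α =ᶠ[𝓝 (c p)] fun _ => 0 :=
    coordRep_eventuallyEq_zero (c.map_source hpc) (by rwa [c.left_inv hpc])
  exact pullback_eq_zero (f := c) (hzero.extDeriv_eq.trans (extDeriv_fun_const 0 _))

theorem IsCr.contDiffOn_coordRep {r : WithTop ℕ∞} {α : Form n M k} (hα : IsCr r α)
    (he : e ∈ IsManifold.maximalAtlas (𝓡 n) 2 M) : ContDiffOn ℝ r (coordRep e α) e.target := by
  simpa only [Set.preimage_univ, Set.inter_univ] using hα e he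

theorem isDensityPoint_of_mem_densityPoints {m : ℝ} {A : Set M} {p : M}
    (hpA : p ∈ densityPoints n m A) (he : e ∈ IsManifold.maximalAtlas (𝓡 n) 1 M)
    (hp : p ∈ e.source) : IsDensityPoint volume m (e.symm ⁻¹' A) (e p) := by
  obtain ⟨c, hc, hpc, hdens⟩ := hpA
  have hep : e p ∈ e.target := e.map_source hp
  have hinv : e.symm (e p) = p := e.left_inv hp
  have hce : e.symm (e p) ∈ c.source := by rwa [hinv]
  have hsource : ∀ᶠ x in 𝓝 (e p), e.symm x ∈ c.source :=
    (e.continuousAt_symm hep).eventually (c.open_source.mem_nhds hce)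
  have hdens' : IsDensityPoint volume m (c '' (A ∩ c.source)) (c (e.symm (e p))) := by
    rwa [hinv]
  refine (hdens'.preimage (T := fun x => c (e.symm x)) (S := fun x => e (c.symm x))
    (contDiffAt_transition hc he hep hce) ?_ ?_).mono ?_
  · refine contDiffAt_transition he hc (c.map_source hce) ?_
    rwa [c.left_inv hce, hinv]
  · filter_upwards [hsource, e.open_target.eventually_mem hep] with x hxc hx
    rw [c.left_inv hxc, e.right_inv hx]
  · filter_upwards [hsource] with x hxc
    rintro ⟨a, ⟨haA, hac⟩, hax⟩
    rwa [Set.mem_preimage, ← c.injOn hac hxc hax]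

end CoordRep

section Support

variable {X H V : Type*} [TopologicalSpace X] [TopologicalSpace H] [Zero V]
  {e : OpenPartialHomeomorph X H} {η : H → V}

theorem symm_image_tsupport_subset_source (hηe : tsupport η ⊆ e.target) :
    e.symm '' tsupport η ⊆ e.source :=
  Set.image_subset_iff.2 fun _ hy => e.map_target (hηe hy)

theorem isCompact_symm_image_tsupport (hηc : HasCompactSupport η) (hηe : tsupport η ⊆ e.target) :
    IsCompact (e.symm '' tsupport η) :=
  hηc.isCompact.image_of_continuousOn (e.continuousOn_symm.mono hηe)

end Support

section OfCoord

variable {n : ℕ} {M : Type*} [TopologicalSpace M] [ChartedSpace (EuclideanSpace ℝ (Fin n)) M]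
  {k : ℕ} {e e' : OpenPartialHomeomorph M (EuclideanSpace ℝ (Fin n))}
  {η : EuclideanSpace ℝ (Fin n) → EuclideanSpace ℝ (Fin n) [⋀^Fin k]→L[ℝ] ℝ}
  {y : EuclideanSpace ℝ (Fin n)} {p : M}

open Classical in
/-- The form on `M` whose representation in the chart `e` is `η`, extended by zero outside the
domain of `e`. -/
def ofCoord (e : OpenPartialHomeomorph M (EuclideanSpace ℝ (Fin n)))
    (η : EuclideanSpace ℝ (Fin n) → EuclideanSpace ℝ (Fin n) [⋀^Fin k]→L[ℝ] ℝ) : Form n M k :=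
  fun p => if p ∈ e.source then pullback e η p else 0

theorem ofCoord_of_mem (η) (hp : p ∈ e.source) : ofCoord (k := k) e η p = pullback e η p :=
  if_pos hp

theorem ofCoord_of_notMem (η) (hp : p ∉ e.source) : ofCoord (k := k) e η p = 0 := if_neg hp

theorem coordRep_ofCoord (he : e ∈ IsManifold.maximalAtlas (𝓡 n) 1 M)
    (η : EuclideanSpace ℝ (Fin n) → EuclideanSpace ℝ (Fin n) [⋀^Fin k]→L[ℝ] ℝ)
    (hy : y ∈ e.target) : coordRep e (ofCoord e η) y = η y := by
  have hpullback : pullback e.symm (pullback e η) y = pullback id η y :=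
    (pullback_pullback (mdifferentiableAt_of_mem_maximalAtlas he (e.map_target hy))
      (mdifferentiableAt_symm_of_mem_maximalAtlas he hy) η).trans
      (pullback_congr_map (e.eventually_right_inverse hy) η)
  exact (pullback_congr_form (ofCoord_of_mem η (e.map_target hy))).trans
    (hpullback.trans (pullback_id η))

theorem coordRep_ofCoord_eventuallyEq (he : e ∈ IsManifold.maximalAtlas (𝓡 n) 1 M)
    (η : EuclideanSpace ℝ (Fin n) → EuclideanSpace ℝ (Fin n) [⋀^Fin k]→L[ℝ] ℝ)
    (hy : y ∈ e.target) : coordRep e (ofCoord e η) =ᶠ[𝓝 y] η :=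
  (e.open_target.eventually_mem hy).mono fun _ => coordRep_ofCoord he η

theorem contDiffAt_coordRep_ofCoord (he : e ∈ IsManifold.maximalAtlas (𝓡 n) 2 M)
    (he' : e' ∈ IsManifold.maximalAtlas (𝓡 n) 2 M) {r : WithTop ℕ∞} (hr : r ≤ 1)
    (hy : y ∈ e'.target) (hy' : e'.symm y ∈ e.source) (hη : ContDiffAt ℝ r η (e (e'.symm y))) :
    ContDiffAt ℝ r (coordRep e' (ofCoord e η)) y := by
  have hτ := contDiffAt_transition he he' hy hy'
  have hpullback : ContDiffAt ℝ r (fun z => (η (e (e'.symm z))).compContinuousLinearMap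
      (fderiv ℝ (fun z => e (e'.symm z)) z)) y := by
    refine contDiff_compContinuousLinearMap.contDiffAt.comp y (ContDiffAt.prodMk ?_ ?_)
    · exact hη.comp y (hτ.of_le (hr.trans one_le_two))
    · exact hτ.fderiv_right ((add_le_add_left hr 1).trans_eq one_add_one_eq_two)
  refine hpullback.congr_of_eventuallyEq ?_
  filter_upwards [e'.open_target.eventually_mem hy,
    (e'.continuousAt_symm hy).eventually (e.open_source.mem_nhds hy')] with z hz hz'
  rw [coordRep_eq_transition (mem_maximalAtlas_one he) (mem_maximalAtlas_one he') _ hz hz',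
    coordRep_ofCoord (mem_maximalAtlas_one he) η (e.map_source hz')]

theorem ofCoord_eq_zero_of_notMem (hp : p ∉ e.symm '' tsupport η) : ofCoord e η p = 0 := by
  by_cases hpe : p ∈ e.source
  · rw [ofCoord_of_mem η hpe]
    exact pullback_eq_zero
      (image_eq_zero_of_notMem_tsupport fun h => hp ⟨e p, h, e.left_inv hpe⟩)
  · exact ofCoord_of_notMem η hpe

variable [T2Space M]

theorem eventually_ofCoord_eq_zero (hηc : HasCompactSupport η) (hηe : tsupport η ⊆ e.target)
    (hp : p ∉ e.symm '' tsupport η) : ∀ᶠ q in 𝓝 p, ofCoord e η q = 0 :=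
  ((isCompact_symm_image_tsupport hηc hηe).isClosed.isOpen_compl.eventually_mem hp).mono
    fun _ => ofCoord_eq_zero_of_notMem

theorem supp_ofCoord_subset (hηc : HasCompactSupport η) (hηe : tsupport η ⊆ e.target) :
    supp (ofCoord e η) ⊆ e.symm '' tsupport η :=
  closure_minimal (fun _ hp => not_imp_comm.1 ofCoord_eq_zero_of_notMem hp)
    (isCompact_symm_image_tsupport hηc hηe).isClosed

theorem isCompact_supp_ofCoord (hηc : HasCompactSupport η) (hηe : tsupport η ⊆ e.target) :
    IsCompact (supp (ofCoord e η)) :=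
  (isCompact_symm_image_tsupport hηc hηe).of_isClosed_subset isClosed_closure
    (supp_ofCoord_subset hηc hηe)

theorem isCr_one_ofCoord (he : e ∈ IsManifold.maximalAtlas (𝓡 n) 2 M) (hη : ContDiff ℝ 1 η)
    (hηc : HasCompactSupport η) (hηe : tsupport η ⊆ e.target) : IsCr 1 (ofCoord e η) := by
  intro c hc y hy
  refine ContDiffAt.contDiffWithinAt ?_
  by_cases hyη : c.symm y ∈ e.symm '' tsupport η
  · exact contDiffAt_coordRep_ofCoord he hc le_rfl hy.1
      (symm_image_tsupport_subset_source hηe hyη) hη.contDiffAt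
  · exact contDiffAt_const.congr_of_eventuallyEq
      (coordRep_eventuallyEq_zero hy.1 (eventually_ofCoord_eq_zero hηc hηe hyη))

theorem extD_ofCoord [IsManifold (𝓡 n) 2 M] (he : e ∈ IsManifold.maximalAtlas (𝓡 n) 2 M)
    (hη : Differentiable ℝ η) (hηc : HasCompactSupport η) (hηe : tsupport η ⊆ e.target) :
    extD (ofCoord e η) = ofCoord e (extDeriv η) := by
  funext p
  by_cases hpe : p ∈ e.source
  · have hrep := coordRep_ofCoord_eventuallyEq (mem_maximalAtlas_one he) η (e.map_source hpe)
    rw [ofCoord_of_mem _ hpe,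
      extD_eq_pullback_extDeriv he hpe (hrep.differentiableAt_iff.2 (hη _))]
    exact pullback_congr_form hrep.extDeriv_eq
  · have hp : p ∉ e.symm '' tsupport η := fun h => hpe (symm_image_tsupport_subset_source hηe h)
    rw [ofCoord_of_notMem _ hpe,
      extD_eq_zero_of_eventually_eq_zero (eventually_ofCoord_eq_zero hηc hηe hp)]

end OfCoord

theorem compContinuousLinearMap_apply_basis {ι E : Type*} [Finite ι] [AddCommGroup E]
    [Module ℝ E] [TopologicalSpace E] (b : Module.Basis ι ℝ E) (a : E [⋀^ι]→L[ℝ] ℝ)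
    (A : E →L[ℝ] E) : a.compContinuousLinearMap A b = A.det * a b := by
  classical
  have := Fintype.ofFinite ι
  calc a.compContinuousLinearMap A b
      = a b * b.det (A ∘ b) :=
        DFunLike.congr_fun (AlternatingMap.eq_smul_basis_det b a.toAlternatingMap) (A ∘ b)
    _ = a b * (A.det * b.det b) := congrArg (a b * ·) (b.det_comp (A : E →ₗ[ℝ] E) b)
    _ = A.det * a b := by rw [b.det_self, mul_one, mul_comm]

/-- The form `dx₁ ∧ … ∧ dxₙ` on `ℝⁿ`. -/
def stdVolumeForm (n : ℕ) : EuclideanSpace ℝ (Fin n) [⋀^Fin n]→L[ℝ] ℝ :=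
  { (EuclideanSpace.basisFun (Fin n) ℝ).toBasis.det with
    cont := by
      refine Continuous.matrix_det (continuous_matrix fun i j => ?_)
      exact (EuclideanSpace.proj i).continuous.comp (continuous_apply j) }

theorem stdVolumeForm_basisFun (n : ℕ) :
    stdVolumeForm n (EuclideanSpace.basisFun (Fin n) ℝ).toBasis = 1 :=
  (EuclideanSpace.basisFun (Fin n) ℝ).toBasis.det_self

section PartitionOfUnity

variable {ι M X : Type*} [TopologicalSpace M] [TopologicalSpace X] [MeasurableSpace X]
  [OpensMeasurableSpace X] [T2Space X]

/-- Only finitely many functions of the partition are nonzero somewhere on the compact set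
`s '' T`, and they sum to one there. -/
theorem finsum_setIntegral_partitionOfUnity_mul (ρ : PartitionOfUnity ι M) {ν : Measure X}
    [IsFiniteMeasureOnCompacts ν] {s : X → M} {F : X → ℝ} {V T : Set X} (hV : MeasurableSet V)
    (hs : ContinuousOn s V) (hF : ContinuousOn F V) (hT : IsCompact T) (hTV : T ⊆ V)
    (hFT : ∀ x ∈ V \ T, F x = 0) :
    ∑ᶠ i, ∫ x in V, ρ i (s x) * F x ∂ν = ∫ x in V, F x ∂ν := by
  have hfin : {i | (Function.support (ρ i) ∩ s '' T).Nonempty}.Finite :=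
    ρ.locallyFinite.finite_nonempty_inter_compact (hT.image_of_continuousOn (hs.mono hTV))
  have hzero (i : ι) (hi : i ∉ hfin.toFinset) (x : X) (hx : x ∈ V) : ρ i (s x) * F x = 0 := by
    by_cases hxT : x ∈ T
    · have hρ : ρ i (s x) = 0 := by
        by_contra hne
        exact hi (hfin.mem_toFinset.2 ⟨s x, hne, x, hxT, rfl⟩)
      rw [hρ, zero_mul]
    · rw [hFT x ⟨hx, hxT⟩, mul_zero]
  have hint (i : ι) : IntegrableOn (fun x => ρ i (s x) * F x) V ν := by
    have hcont : ContinuousOn (fun x => ρ i (s x) * F x) V :=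
      ((ρ i).continuous.comp_continuousOn hs).mul hF
    refine IntegrableOn.of_forall_sdiff_eq_zero
      ((hcont.mono hTV).integrableOn_compact hT) hV fun x hx => ?_
    rw [hFT x hx, mul_zero]
  have hsum (x : X) (hx : x ∈ V) : ∑ i ∈ hfin.toFinset, ρ i (s x) * F x = F x := by
    by_cases hxT : x ∈ T
    · rw [← Finset.sum_mul, ρ.sum_finsupport' (Set.mem_univ _) fun i hi =>
        hfin.mem_toFinset.2 ⟨s x, (ρ.mem_finsupport _).1 hi, x, hxT, rfl⟩, one_mul]
    · simp only [hFT x ⟨hx, hxT⟩, mul_zero, Finset.sum_const_zero]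
  calc ∑ᶠ i, ∫ x in V, ρ i (s x) * F x ∂ν
      = ∑ i ∈ hfin.toFinset, ∫ x in V, ρ i (s x) * F x ∂ν :=
        finsum_eq_sum_of_support_subset _ fun i hi => by_contra fun hi' =>
          hi (setIntegral_eq_zero_of_forall_eq_zero (hzero i hi'))
    _ = ∫ x in V, ∑ i ∈ hfin.toFinset, ρ i (s x) * F x ∂ν :=
        (integral_finsetSum _ fun i _ => hint i).symm
    _ = ∫ x in V, F x ∂ν := setIntegral_congr_fun hV hsum

end PartitionOfUnity

section TopDegree

variable {n : ℕ} {M : Type*} [TopologicalSpace M] [ChartedSpace (EuclideanSpace ℝ (Fin n)) M]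
  {e c : OpenPartialHomeomorph M (EuclideanSpace ℝ (Fin n))} {y : EuclideanSpace ℝ (Fin n)}

theorem coeff_eq_apply_toBasis (α : Form n M n) (y : EuclideanSpace ℝ (Fin n)) :
    coeff e α y = coordRep e α y (EuclideanSpace.basisFun (Fin n) ℝ).toBasis := by
  rw [OrthonormalBasis.coe_toBasis]
  rfl

theorem coeff_eq_zero {α : Form n M n} (h : α (e.symm y) = 0) : coeff e α y = 0 := by
  rw [coeff_eq_apply_toBasis, coordRep_eq_pullback, pullback_eq_zero h]
  rfl

theorem coeff_eq_det_mul (he : e ∈ IsManifold.maximalAtlas (𝓡 n) 1 M)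
    (hc : c ∈ IsManifold.maximalAtlas (𝓡 n) 1 M) (α : Form n M n) (hy : y ∈ c.target)
    (hy' : c.symm y ∈ e.source) :
    coeff c α y = (fderiv ℝ (fun z => e (c.symm z)) y).det * coeff e α (e (c.symm y)) := by
  rw [coeff_eq_apply_toBasis, coordRep_eq_transition he hc α hy hy',
    compContinuousLinearMap_apply_basis, coeff_eq_apply_toBasis]

/-- The form equal to `dx₁ ∧ … ∧ dxₙ` in the coordinates of `e`; it orients `e.source` so that `e`
is a positive chart. -/
def chartOrientation (e : OpenPartialHomeomorph M (EuclideanSpace ℝ (Fin n))) : Form n M n :=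
  ofCoord e fun _ => stdVolumeForm n

theorem coeff_chartOrientation (he : e ∈ IsManifold.maximalAtlas (𝓡 n) 1 M) (hy : y ∈ e.target) :
    coeff e (chartOrientation e) y = 1 := by
  rw [coeff_eq_apply_toBasis, chartOrientation, coordRep_ofCoord he _ hy, stdVolumeForm_basisFun]

theorem isOrientationOn_chartOrientation (he : e ∈ IsManifold.maximalAtlas (𝓡 n) 2 M) :
    IsOrientationOn (chartOrientation e) e.source := by
  refine ⟨e.open_source, fun c hc y hy => ?_, fun p hp hzero => ?_⟩
  · exact (contDiffAt_coordRep_ofCoord he hc zero_le_one hy.1 hy.2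
      contDiffAt_const).contDiffWithinAt
  · have hcoeff := coeff_chartOrientation (mem_maximalAtlas_one he) (e.map_source hp)
    rw [coeff_eq_zero (by rwa [e.left_inv hp])] at hcoeff
    exact zero_ne_one hcoeff

theorem setIntegral_overlap (he : e ∈ IsManifold.maximalAtlas (𝓡 n) 1 M)
    (hc : c ∈ IsManifold.maximalAtlas (𝓡 n) 1 M) (α : Form n M n) (g : M → ℝ) :
    ∫ y in c.target ∩ c.symm ⁻¹' e.source,
        g (c.symm y) * (SignType.sign (coeff c (chartOrientation e) y) : ℝ) * coeff c α y =
      ∫ x in e.target ∩ e.symm ⁻¹' c.source, g (e.symm x) * coeff e α x := by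
  let τ := c.symm.trans e
  have hτ (y) (hy : y ∈ τ.source) : HasFDerivWithinAt τ (fderiv ℝ τ y) τ.source y :=
    ((contDiffAt_transition he hc hy.1 hy.2).differentiableAt
      one_ne_zero).hasFDerivAt.hasFDerivWithinAt
  have hdensity (y) (hy : y ∈ τ.source) :
      g (c.symm y) * (SignType.sign (coeff c (chartOrientation e) y) : ℝ) * coeff c α y =
        |(fderiv ℝ τ y).det| • (g (e.symm (τ y)) * coeff e α (τ y)) := by
    have hye : c.symm y ∈ e.source := hy.2
    have hinv : e.symm (τ y) = c.symm y := e.left_inv hye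
    have hα : coeff c α y = (fderiv ℝ τ y).det * coeff e α (τ y) :=
      coeff_eq_det_mul he hc α hy.1 hye
    have hsign : coeff c (chartOrientation e) y = (fderiv ℝ τ y).det := by
      rw [coeff_eq_det_mul he hc _ hy.1 hye, coeff_chartOrientation he (e.map_source hye), mul_one]
      rfl
    rw [hsign, hα, hinv, ← sign_mul_self, smul_eq_mul]
    ring
  change ∫ y in τ.source, _ = ∫ x in τ.target, _
  rw [← τ.image_source_eq_target, integral_image_eq_integral_abs_det_fderiv_smul volume
    τ.open_source.measurableSet hτ τ.injOn]
  exact setIntegral_congr_fun τ.open_source.measurableSet hdensity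

theorem setIntegral_target_eq_of_tsupport_subset (he : e ∈ IsManifold.maximalAtlas (𝓡 n) 1 M)
    (hc : c ∈ IsManifold.maximalAtlas (𝓡 n) 1 M) {α : Form n M n} (hα : ∀ p ∉ e.source, α p = 0)
    {g : M → ℝ} (hg : tsupport g ⊆ c.source) :
    ∫ y in c.target,
        g (c.symm y) * (SignType.sign (coeff c (chartOrientation e) y) : ℝ) * coeff c α y =
      ∫ x in e.target, g (e.symm x) * coeff e α x := by
  rw [setIntegral_eq_of_subset_of_forall_sdiff_eq_zero c.open_target.measurableSet
      (Set.inter_subset_left (t := c.symm ⁻¹' e.source)) fun y hy => ?_,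
    setIntegral_overlap he hc α g]
  · refine (setIntegral_eq_of_subset_of_forall_sdiff_eq_zero e.open_target.measurableSet
      Set.inter_subset_left fun x hx => ?_).symm
    rw [image_eq_zero_of_notMem_tsupport fun h => hx.2 ⟨hx.1, hg h⟩, zero_mul]
  · rw [coeff_eq_zero (hα _ fun h => hy.2 ⟨hy.1, h⟩), mul_zero]

theorem integral_chartOrientation [T2Space M] [SecondCountableTopology M] [IsManifold (𝓡 n) 1 M]
    (he : e ∈ IsManifold.maximalAtlas (𝓡 n) 1 M) {T : Set (EuclideanSpace ℝ (Fin n))}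
    (hT : IsCompact T) (hTe : T ⊆ e.target) {α : Form n M n} (hαT : ∀ p ∉ e.symm '' T, α p = 0)
    (hα : ContinuousOn (coeff e α) e.target) :
    integral (chartOrientation e) α = ∫ y in e.target, coeff e α y := by
  have hρ : (chartPartition n M).IsSubordinate fun p =>
      (chartAt (EuclideanSpace ℝ (Fin n)) p).source := (exists_partitionOfUnity n M).choose_spec
  have hαe (p) (hp : p ∉ e.source) : α p = 0 := by
    refine hαT p fun ⟨y, hy, hyp⟩ => hp ?_
    exact hyp ▸ e.map_target (hTe hy)
  rw [integral, finsum_congr fun p => setIntegral_target_eq_of_tsupport_subset he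
    (IsManifold.chart_mem_maximalAtlas p) hαe (hρ p)]
  refine finsum_setIntegral_partitionOfUnity_mul _ e.open_target.measurableSet
    e.continuousOn_symm hα hT hTe fun y hy => coeff_eq_zero (hαT _ fun ⟨z, hz, hzy⟩ => hy.2 ?_)
  exact e.symm.injOn (hTe hz) hy.1 hzy ▸ hz

end TopDegree

theorem continuousOn_wedge_apply {X E : Type*} [TopologicalSpace X] [NormedAddCommGroup E]
    [NormedSpace ℝ E] {k l m : ℕ} (hm : k + l = m) {a : X → E [⋀^Fin k]→L[ℝ] ℝ}
    {b : X → E [⋀^Fin l]→L[ℝ] ℝ} {S : Set X} (ha : ContinuousOn a S) (hb : ContinuousOn b S)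
    (v : Fin m → E) : ContinuousOn (fun x => wedge hm (a x) (b x) v) S := by
  simp only [wedge_apply]
  refine continuousOn_finsetSum _ fun σ _ => continuousOn_const.mul ?_
  exact (continuousOn_const.mul
      ((ContinuousAlternatingMap.apply ℝ E ℝ _).continuous.comp_continuousOn ha)).mul
    (continuousOn_const.mul
      ((ContinuousAlternatingMap.apply ℝ E ℝ _).continuous.comp_continuousOn hb))

section FormWedge

variable {n : ℕ} {M : Type*} [TopologicalSpace M] [ChartedSpace (EuclideanSpace ℝ (Fin n)) M]
  {k l m L : ℕ} {e : OpenPartialHomeomorph M (EuclideanSpace ℝ (Fin n))}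

/-- The exterior product of two scalar forms on `M`; `matWedge` is its matrix version. -/
def formWedge (hm : k + l = m) (α : Form n M k) (β : Form n M l) : Form n M m :=
  fun p => wedge (E := TangentSpace (𝓡 n) p) hm (α p) (β p)

theorem matWedge_single (hm : k + l = m) (a : MatForm L n M k) (β : Form n M l) (i s j : Fin L) :
    matWedge hm a (Matrix.single s j β) i j = formWedge hm (a i s) β := by
  funext p
  refine (Finset.sum_eq_single_of_mem s (Finset.mem_univ s) fun t _ hts => ?_).trans ?_
  · rw [Matrix.single_apply_of_row_ne hts.symm]
    exact wedge_zero_right hm _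
  · rw [Matrix.single_apply_same]
    rfl

theorem coordRep_formWedge (hm : k + l = m) (α : Form n M k) (β : Form n M l)
    (y : EuclideanSpace ℝ (Fin n)) :
    coordRep e (formWedge hm α β) y = wedge hm (coordRep e α y) (coordRep e β y) :=
  wedge_compContinuousLinearMap hm _ _ _

theorem integral_formWedge_ofCoord [T2Space M] [SecondCountableTopology M] [IsManifold (𝓡 n) 1 M]
    (he : e ∈ IsManifold.maximalAtlas (𝓡 n) 1 M) (hm : k + l = n) {α : Form n M k}
    (hα : ContinuousOn (coordRep e α) e.target)
    {ζ : EuclideanSpace ℝ (Fin n) → EuclideanSpace ℝ (Fin n) [⋀^Fin l]→L[ℝ] ℝ}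
    (hζ : Continuous ζ) (hζc : HasCompactSupport ζ) (hζe : tsupport ζ ⊆ e.target) :
    integral (chartOrientation e) (formWedge hm α (ofCoord e ζ)) =
      ∫ y, wedge hm (coordRep e α y) (ζ y) (EuclideanSpace.basisFun (Fin n) ℝ).toBasis := by
  have hcoeff (y) (hy : y ∈ e.target) : coeff e (formWedge hm α (ofCoord e ζ)) y =
      wedge hm (coordRep e α y) (ζ y) (EuclideanSpace.basisFun (Fin n) ℝ).toBasis := by
    rw [coeff_eq_apply_toBasis, coordRep_formWedge, coordRep_ofCoord he ζ hy]
  have hzero (p) (hp : p ∉ e.symm '' tsupport ζ) : formWedge hm α (ofCoord e ζ) p = 0 := by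
    rw [formWedge, ofCoord_eq_zero_of_notMem hp]
    exact wedge_zero_right hm _
  calc integral (chartOrientation e) (formWedge hm α (ofCoord e ζ))
      = ∫ y in e.target, coeff e (formWedge hm α (ofCoord e ζ)) y :=
        integral_chartOrientation he hζc.isCompact hζe hzero
          ((continuousOn_wedge_apply hm hα hζ.continuousOn _).congr hcoeff)
    _ = ∫ y in e.target, wedge hm (coordRep e α y) (ζ y)
          (EuclideanSpace.basisFun (Fin n) ℝ).toBasis :=
        setIntegral_congr_fun e.open_target.measurableSet hcoeff
    _ = ∫ y, wedge hm (coordRep e α y) (ζ y) (EuclideanSpace.basisFun (Fin n) ℝ).toBasis :=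
        setIntegral_eq_integral_of_forall_compl_eq_zero fun y hy => by
          rw [image_eq_zero_of_notMem_tsupport fun h => hy (hζe h), wedge_zero_right]
          rfl

end FormWedge

section IsDED

variable {n : ℕ} {M : Type*} [TopologicalSpace M] [ChartedSpace (EuclideanSpace ℝ (Fin n)) M]
  [T2Space M] [SecondCountableTopology M] {h q L : ℕ} {μ : MatForm L n M h}
  {δ : MatForm L n M (h + 1)}

/-- Testing with a matrix that has a single nonzero entry separates the entries of `μ`. -/
theorem IsDED.integral_formWedge_extD (hded : IsDED μ δ) {U : Set M} {σ : Form n M n}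
    (hσ : IsOrientationOn σ U) (hq : h + 1 + q = n) (hq' : h + (q + 1) = n) {β : Form n M q}
    (hβ : IsCr 1 β) (hβc : IsCompact (supp β)) (hβU : supp β ⊆ U) (i j : Fin L) :
    integral σ (formWedge hq' (μ i j) (extD β)) =
      (-1) ^ (h + 1) * integral σ (formWedge hq (δ i j) β) := by
  have hsupp : supp (0 : Form n M q) = ∅ := by simp [supp]
  have hzero : IsCr 1 (0 : Form n M q) ∧ IsCompact (supp (0 : Form n M q)) ∧
      supp (0 : Form n M q) ⊆ U := by
    rw [hsupp]
    refine ⟨fun e _ => ?_, isCompact_empty, Set.empty_subset U⟩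
    exact (contDiffOn_const (c := (0 : EuclideanSpace ℝ (Fin n) [⋀^Fin q]→L[ℝ] ℝ))).congr
      fun y _ => pullback_eq_zero rfl
  have hextD : extD (0 : Form n M q) = 0 :=
    funext fun p => extD_eq_zero_of_eventually_eq_zero (Eventually.of_forall fun _ => rfl)
  have hmap : (Matrix.single j j β).map extD = Matrix.single j j (extD β) := by
    ext1 s t
    simp only [Matrix.map_apply, Matrix.single_apply, apply_ite extD, hextD]
  have htest := hded U σ hσ q hq (Matrix.single j j β) (fun s t => by
    rw [Matrix.single_apply]
    split_ifs
    exacts [⟨hβ, hβc, hβU⟩, hzero]) i j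
  rwa [hmap, matWedge_single, matWedge_single] at htest

variable [IsManifold (𝓡 n) 2 M] {e : OpenPartialHomeomorph M (EuclideanSpace ℝ (Fin n))}
  {i j : Fin L}

/-- The test form is `χ c` with `c` a constant form in the coordinates of `e`. -/
theorem IsDED.integral_wedge_coordRep (hded : IsDED μ δ)
    (he : e ∈ IsManifold.maximalAtlas (𝓡 n) 2 M)
    (hμ : ContinuousOn (coordRep e (μ i j)) e.target)
    (hδ : ContinuousOn (coordRep e (δ i j)) e.target) (hq : h + 1 + q = n)
    (c : EuclideanSpace ℝ (Fin n) [⋀^Fin q]→L[ℝ] ℝ) {χ : EuclideanSpace ℝ (Fin n) → ℝ}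
    (hχ : ContDiff ℝ 1 χ) (hχc : HasCompactSupport χ) (hχe : tsupport χ ⊆ e.target) :
    ∫ y, wedge hq (covecWedge (fderiv ℝ χ y) (coordRep e (μ i j) y)) c
        (EuclideanSpace.basisFun (Fin n) ℝ).toBasis =
      -∫ y, wedge hq (χ y • coordRep e (δ i j) y) c
        (EuclideanSpace.basisFun (Fin n) ℝ).toBasis := by
  have hq' : h + (q + 1) = n := by omega
  have he1 := mem_maximalAtlas_one he
  let ζ := fun y => χ y • c
  have hζ : ContDiff ℝ 1 ζ := hχ.smul contDiff_const
  have hζc : HasCompactSupport ζ := hχc.smul_right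
  have hζe : tsupport ζ ⊆ e.target := (tsupport_smul_subset_left χ _).trans hχe
  have hdζ (y) : extDeriv ζ y = covecWedge (fderiv ℝ χ y) c := by
    rw [extDeriv_smul_fun (hχ.differentiable one_ne_zero y) (differentiableAt_const c),
      extDeriv_fun_const, smul_zero, add_zero]
  have hdζe : tsupport (extDeriv ζ) ⊆ tsupport ζ :=
    closure_minimal (support_extDeriv_subset ζ) (isClosed_tsupport ζ)
  have htest := hded.integral_formWedge_extD (isOrientationOn_chartOrientation he) hq hq'
    (isCr_one_ofCoord he hζ hζc hζe) (isCompact_supp_ofCoord hζc hζe)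
    ((supp_ofCoord_subset hζc hζe).trans (symm_image_tsupport_subset_source hζe)) i j
  rw [extD_ofCoord he (hζ.differentiable one_ne_zero) hζc hζe,
    integral_formWedge_ofCoord he1 hq' hμ (continuous_extDeriv hζ)
      (hζc.mono' (support_extDeriv_subset ζ)) (hdζe.trans hζe),
    integral_formWedge_ofCoord he1 hq hδ hζ.continuous hζc hζe] at htest
  simp only [hdζ, wedge_covecWedge hq' hq, ContinuousAlternatingMap.smul_apply, ζ,
    wedge_smul_right, integral_const_mul, smul_eq_mul] at htest
  simp only [wedge_smul_left, ContinuousAlternatingMap.smul_apply, smul_eq_mul]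
  refine mul_left_cancel₀ (pow_ne_zero h (neg_ne_zero.2 (one_ne_zero (α := ℝ)))) ?_
  rw [htest, pow_succ, mul_neg_one, neg_mul, mul_neg]

theorem IsDED.isWeakExtDerivOn_coordRep (hded : IsDED μ δ) (hn : h + 1 ≤ n)
    (he : e ∈ IsManifold.maximalAtlas (𝓡 n) 2 M)
    (hμ : ContinuousOn (coordRep e (μ i j)) e.target)
    (hδ : ContinuousOn (coordRep e (δ i j)) e.target) :
    IsWeakExtDerivOn volume (coordRep e (μ i j)) (coordRep e (δ i j)) e.target := by
  intro χ hχ hχc hχe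
  have hχ1 : ContDiff ℝ 1 χ := hχ.of_le (mod_cast le_top)
  obtain ⟨q, hq⟩ := Nat.exists_eq_add_of_le hn
  have hintμ : Integrable fun y => covecWedge (fderiv ℝ χ y) (coordRep e (μ i j) y) :=
    integrable_covecWedge_fderiv e.open_target hχ1 hχc hχe hμ
  have hintδ : Integrable fun y => χ y • coordRep e (δ i j) y :=
    integrable_smul_form e.open_target hχ.continuous hχc hχe hδ
  refine eq_zero_of_wedge_eq_zero hq.symm finrank_euclideanSpace_fin.ge fun c => ?_
  refine ContinuousAlternatingMap.toAlternatingMap_injective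
    ((AlternatingMap.map_basis_eq_zero_iff (EuclideanSpace.basisFun (Fin n) ℝ).toBasis _).1 ?_)
  let Λ := wedgeCLM hq.symm c (EuclideanSpace.basisFun (Fin n) ℝ).toBasis
  change Λ _ = 0
  rw [integral_add hintμ hintδ, map_add, ← Λ.integral_comp_comm hintμ,
    ← Λ.integral_comp_comm hintδ]
  exact eq_neg_iff_add_eq_zero.1 (hded.integral_wedge_coordRep he hμ hδ hq.symm c hχ1 hχc hχe)

end IsDED

theorem densityPoints_mono {n : ℕ} {M : Type*} [TopologicalSpace M]
    [ChartedSpace (EuclideanSpace ℝ (Fin n)) M] {m : ℝ} {A B : Set M} (hAB : A ⊆ B) :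
    densityPoints n m A ⊆ densityPoints n m B := by
  rintro p ⟨e, he, hp, hA⟩
  refine ⟨e, he, hp, (Asymptotics.IsBigO.of_norm_le fun r => ?_).trans_isLittleO hA⟩
  rw [Real.norm_of_nonneg ENNReal.toReal_nonneg]
  refine ENNReal.toReal_mono (measure_ne_top_of_subset Set.sdiff_subset measure_ball_lt_top.ne) ?_
  gcongr

section Contact

variable {n n' h : ℕ}
  {M : Type*} [TopologicalSpace M] [ChartedSpace (EuclideanSpace ℝ (Fin n)) M]
  {N : Type*} [TopologicalSpace N] [ChartedSpace (EuclideanSpace ℝ (Fin n')) N]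
  {e : OpenPartialHomeomorph M (EuclideanSpace ℝ (Fin n))}
  {c : OpenPartialHomeomorph N (EuclideanSpace ℝ (Fin n'))} {f : M → N} {Q : M}

theorem contDiffAt_coordinate_map (he : e ∈ IsManifold.maximalAtlas (𝓡 n) 1 M)
    (hc : c ∈ IsManifold.maximalAtlas (𝓡 n') 1 N) (hQ : Q ∈ e.source) (hfQ : f Q ∈ c.source)
    (hf : ContMDiffAt (𝓡 n) (𝓡 n') 1 f Q) :
    ContDiffAt ℝ 1 (fun z => c (f (e.symm z))) (e Q) := by
  have hfe : ContMDiffAt (𝓡 n) (𝓡 n') 1 (fun z => f (e.symm z)) (e Q) :=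
    hf.comp_of_eq (contMDiffAt_symm_of_mem_maximalAtlas he (e.map_source hQ)) (e.left_inv hQ)
  exact contMDiffAt_iff_contDiffAt.1
    ((contMDiffAt_of_mem_maximalAtlas hc hfQ).comp_of_eq hfe (congrArg f (e.left_inv hQ)))

theorem pullback_coordinate_map [IsManifold (𝓡 n) 1 M] [IsManifold (𝓡 n') 1 N]
    (he : e ∈ IsManifold.maximalAtlas (𝓡 n) 1 M) (hc : c ∈ IsManifold.maximalAtlas (𝓡 n') 1 N)
    (hQ : Q ∈ e.source) (hfQ : f Q ∈ c.source) (hf : ContMDiffAt (𝓡 n) (𝓡 n') 1 f Q)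
    (β : EuclideanSpace ℝ (Fin n') → EuclideanSpace ℝ (Fin n') [⋀^Fin h]→L[ℝ] ℝ) :
    pullback e (pullback (n := n) (fun z => c (f (e.symm z))) β) Q =
      pullback (n := n) f (pullback (n := n') c β) Q :=
  calc pullback e (pullback (n := n) (fun z => c (f (e.symm z))) β) Q
      = pullback (n := n) (fun P => c (f (e.symm (e P)))) β Q :=
        pullback_pullback
          ((contDiffAt_coordinate_map he hc hQ hfQ hf).differentiableAt
            one_ne_zero).mdifferentiableAt
          (mdifferentiableAt_of_mem_maximalAtlas he hQ) β
    _ = pullback (n := n) (fun P => c (f P)) β Q :=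
        pullback_congr_map
          ((e.eventually_left_inverse hQ).mono fun _ hP => congrArg (fun P => c (f P)) hP) β
    _ = pullback (n := n) f (pullback (n := n') c β) Q :=
        (pullback_pullback (mdifferentiableAt_of_mem_maximalAtlas hc hfQ)
          (hf.mdifferentiableAt one_ne_zero) β).symm

theorem isDensityPoint_coordRep_eq [IsManifold (𝓡 n) 1 M] [IsManifold (𝓡 n') 1 N]
    (he : e ∈ IsManifold.maximalAtlas (𝓡 n) 1 M) (hc : c ∈ IsManifold.maximalAtlas (𝓡 n') 1 N)
    (hQ : Q ∈ e.source) (hfQ : f Q ∈ c.source) (hf : ContMDiffAt (𝓡 n) (𝓡 n') 1 f Q)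
    {α : Form n M h} {ω : Form n' N h} {m : ℝ}
    (hdens : Q ∈ densityPoints n m {P | α P = pullback f ω P}) :
    IsDensityPoint volume m {y | coordRep e α y =
      (coordRep c ω (c (f (e.symm y)))).compContinuousLinearMap
        (fderiv ℝ (fun z => c (f (e.symm z))) y)} (e Q) := by
  have hf1 := (contMDiffAt_iff_contMDiffAt_nhds (by simp)).1 hf
  have hnear : ∀ᶠ P in 𝓝 Q, MDifferentiableAt (𝓡 n) (𝓡 n') f P ∧ f P ∈ c.source :=
    (hf1.mono fun _ hP => hP.mdifferentiableAt one_ne_zero).and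
      (hf.continuousAt (c.open_source.mem_nhds hfQ))
  refine (isDensityPoint_of_mem_densityPoints hdens he hQ).mono ?_
  filter_upwards [e.open_target.mem_nhds (e.map_source hQ), (e.tendsto_symm hQ).eventually hnear]
    with y hy hfy hyA
  exact (pullback_congr_form hyA).trans (coordRep_pullback ω he hc hy hfy.1 hfy.2)

end Contact

end ManifoldForms

end

open ManifoldForms in
theorem corollary3p1_general {n n' h L : ℕ}
    {M : Type*} [TopologicalSpace M] [T2Space M] [SecondCountableTopology M]
    [ChartedSpace (EuclideanSpace ℝ (Fin n)) M] [IsManifold (𝓡 n) 2 M]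
    {N : Type*} [TopologicalSpace N] [ChartedSpace (EuclideanSpace ℝ (Fin n')) N]
    [IsManifold (𝓡 n') 2 N] (hn : h + 1 ≤ n) {f : M → N} {Q : M}
    (hf : ContMDiffAt (𝓡 n) (𝓡 n') 1 f Q) {ω : Form n' N h} (hω : IsCr 1 ω)
    {μ : MatForm L n M h} {δμ : MatForm L n M (h + 1)} (hded : IsDED μ δμ) {i j : Fin L}
    (hμ : IsCr 0 (μ i j)) (hδμ : IsCr 0 (δμ i j))
    (hQ : Q ∈ densityPoints n ((n : ℝ) + 1) {P : M | μ i j P = pullback f ω P}) :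
    δμ i j Q = pullback f (extD ω) Q := by
  let e := chartAt (EuclideanSpace ℝ (Fin n)) Q
  let c := chartAt (EuclideanSpace ℝ (Fin n')) (f Q)
  have he : e ∈ IsManifold.maximalAtlas (𝓡 n) 2 M := IsManifold.chart_mem_maximalAtlas Q
  have hc : c ∈ IsManifold.maximalAtlas (𝓡 n') 2 N := IsManifold.chart_mem_maximalAtlas (f Q)
  have he1 := mem_maximalAtlas_one he
  have hc1 := mem_maximalAtlas_one hc
  have hQe : Q ∈ e.source := mem_chart_source _ Q
  have hfQ : f Q ∈ c.source := mem_chart_source _ (f Q)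
  have hμe := (hμ.contDiffOn_coordRep he).continuousOn
  have hδe := (hδμ.contDiffOn_coordRep he).continuousOn
  have hωc : ContDiffAt ℝ 1 (coordRep c ω) (c (f Q)) :=
    (hω.contDiffOn_coordRep hc).contDiffAt (c.open_target.mem_nhds (c.map_source hfQ))
  have hcoord : coordRep e (δμ i j) (e Q) =
      pullback (fun z => c (f (e.symm z))) (extDeriv (coordRep c ω)) (e Q) := by
    rw [pullback_eq_compContinuousLinearMap_fderiv]
    refine (hded.isWeakExtDerivOn_coordRep hn he hμe hδe).eq_pullback_extDeriv_of_isDensityPoint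
      e.open_target hμe hδe (e.map_source hQe)
      (contDiffAt_coordinate_map he1 hc1 hQe hfQ hf) (by rwa [e.left_inv hQe]) ?_
    rw [finrank_euclideanSpace_fin]
    exact isDensityPoint_coordRep_eq he1 hc1 hQe hfQ hf hQ
  calc δμ i j Q = pullback e (coordRep e (δμ i j)) Q := (pullback_coordRep he1 _ hQe).symm
    _ = pullback e (pullback (n := n) (fun z => c (f (e.symm z))) (extDeriv (coordRep c ω))) Q :=
      pullback_congr_form hcoord
    _ = pullback f (pullback c (extDeriv (coordRep c ω))) Q :=
      pullback_coordinate_map he1 hc1 hQe hfQ hf _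
    _ = pullback f (extD ω) Q :=
      pullback_congr_form
        (extD_eq_pullback_extDeriv hc hfQ (hωc.differentiableAt one_ne_zero)).symm

theorem corollary3p1 {n n' h L : ℕ}
    {M : Type*} [TopologicalSpace M] [T2Space M] [SecondCountableTopology M]
    [ChartedSpace (EuclideanSpace ℝ (Fin n)) M] [IsManifold (𝓡 n) 2 M]
    {N : Type*} [TopologicalSpace N] [T2Space N] [SecondCountableTopology N]
    [ChartedSpace (EuclideanSpace ℝ (Fin n')) N] [IsManifold (𝓡 n') 2 N]
    (hn : h + 1 ≤ n)
    (f : M → N) (hf : ContMDiff (𝓡 n) (𝓡 n') 1 f)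
    (ω : ManifoldForms.MatForm L n' N h) (hω : ∀ i j, ManifoldForms.IsCr 1 (ω i j))
    (μ : ManifoldForms.MatForm L n M h) (hμ : ∀ i j, ManifoldForms.IsCr 0 (μ i j))
    (δμ : ManifoldForms.MatForm L n M (h + 1)) (hδμ : ∀ i j, ManifoldForms.IsCr 0 (δμ i j))
    (hded : ManifoldForms.IsDED μ δμ)
    (Q : M)
    (hQ : Q ∈ ManifoldForms.densityPoints n ((n : ℝ) + 1)
      {P : M | ∀ i j, μ i j P = ManifoldForms.pullback f (ω i j) P}) :
    ∀ i j, δμ i j Q = ManifoldForms.pullback f (ManifoldForms.extD (ω i j)) Q := fun i j =>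
  corollary3p1_general hn (hf Q) (hω i j) hded (hμ i j) (hδμ i j)
    (ManifoldForms.densityPoints_mono
      (fun P (hP : ∀ i j, μ i j P = ManifoldForms.pullback f (ω i j) P) => hP i j) hQ)
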